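/- Let $V_0$ be a simple Euclidean Jordan algebra, that is, a finite-dimensional real commutative algebra satisfying the Jordan identity $x(x^2y)=x^2(xy)$, whose bilinear form $\beta(x,y)=\operatorname{Tr}L(xy)$, with $L(x)y=xy$, is positive definite, and whose only ideals are $0$ and $V_0\neq 0$; it has an identity element $e$. Let $n=\dim V_0$, let the rank $r$ be the largest degree of the minimal polynomial of an element of $V_0$, and call $x$ regular if its minimal polynomial $f_x$ has degree $r$. Let $\Delta$ be the Jordan determinant, i.e. the polynomial function on $V_0$ such that $(-1)^r\Delta(x)$ is the constant coefficient of $f_x$ for regular $x$. Let $\Omega=\{x^2 : x\in V_0 \text{ invertible}\}$ be the symmetric cone and $T_\Omega=V_0+i\Omega\subset V_0\otimes_{\mathbb R}\mathbb C$ the corresponding tube domain. For $\nu\in\mathbb R$ let $H^2_\nu(T_\Omega)$ be the weighted Bergman space of all holomorphic functions $F:T_\Omega\to\mathbb C$ with $$\|F\|_\nu^2=\int_{T_\Omega}|F(x+iy)|^2\,\Delta(y)^{\nu-2n/r}\,dx\,dy<\infty .$$ Let $\nu_1,\nu_2>\frac{2n}{r}-1$ be real numbers, $F_1\in H^2_{\nu_1}(T_\Omega)$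 and $F_2\in H^2_{\nu_2}(T_\Omega)$. Then the pointwise product $F_1F_2$ belongs to $H^2_{\nu_1+\nu_2}(T_\Omega)$. -/

import Mathlib

open scoped TensorProduct
open Polynomial MeasureTheory

noncomputable section

namespace EJA

section Algebra

variable (V : Type*) [NonUnitalNonAssocCommRing V] [Module ℝ V]
  [IsScalarTower ℝ V V] [SMulCommClass ℝ V V]

variable {V} in
/-- The multiplication operator `L(x) : y ↦ x * y`. -/
def mulL (x : V) : V →ₗ[ℝ] V := LinearMap.mul ℝ V x

/-- The bilinear form `β(x, y) = Tr L(x * y)`. -/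
def traceForm : LinearMap.BilinForm ℝ V :=
  (LinearMap.mul ℝ V).compr₂ ((LinearMap.trace ℝ V).comp (LinearMap.mul ℝ V))

/-- A Euclidean Jordan algebra: a finite-dimensional real commutative algebra satisfying the
Jordan identity, whose form `β(x, y) = Tr L(x * y)` is positive definite. -/
class EuclideanJordanAlgebra : Prop extends IsCommJordan V where
  finiteDimensional : FiniteDimensional ℝ V
  traceForm_pos : ∀ x : V, x ≠ 0 → 0 < traceForm V x x

attribute [instance] EuclideanJordanAlgebra.finiteDimensional

variable {V}

theorem mulL_apply (x y : V) : mulL x y = x * y := rfl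

theorem traceForm_apply (x y : V) :
    traceForm V x y = LinearMap.trace ℝ V (mulL (x * y)) := rfl

theorem traceForm_comm (x y : V) : traceForm V x y = traceForm V y x := by
  rw [traceForm_apply, traceForm_apply, mul_comm]

variable [EuclideanJordanAlgebra V]

theorem jordan_linearized (a b d w : V) :
    a * (d * (b * w)) + b * (d * (a * w)) + a * b * d * w
      = a * d * (b * w) + b * d * (a * w) + a * b * (d * w) := by
  have h := DFunLike.congr_fun (two_nsmul_lie_lmul_lmul_add_add_eq_zero a b w) d
  have h2 : (2 : ℝ) • (a * (b * w * d) - b * w * (a * d) + (b * (w * a * d) - w * a * (b * d))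
      + (w * (a * b * d) - a * b * (w * d))) = 0 := by
    rw [ofNat_smul_eq_nsmul]; exact h
  have h3 := (smul_eq_zero.1 h2).resolve_left two_ne_zero
  rw [mul_comm (b * w) d, mul_comm w a, mul_comm (a * w) d, mul_comm w (a * b * d),
    mul_comm w d, mul_comm (b * w) (a * d), mul_comm (a * w) (b * d)] at h3
  rw [← sub_eq_zero, ← h3]
  abel

/-- The trace form is associative. -/
theorem traceForm_assoc (x y z : V) : traceForm V (x * y) z = traceForm V x (y * z) := by
  have key : ∀ a b d : V, mulL (a * b * d)
      = mulL (a * d) * mulL b + mulL (b * d) * mulL a + mulL (a * b) * mulL d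
        - mulL a * mulL d * mulL b - mulL b * mulL d * mulL a := by
    intro a b d
    ext w
    simp only [LinearMap.add_apply, LinearMap.sub_apply, Module.End.mul_apply, mulL_apply]
    rw [← jordan_linearized a b d w]
    abel
  have t : ∀ a b : V →ₗ[ℝ] V, LinearMap.trace ℝ V (a * b) = LinearMap.trace ℝ V (b * a) :=
    LinearMap.trace_mul_comm ℝ
  rw [traceForm_apply, traceForm_apply, mul_comm x (y * z), key x y z, key y z x]
  simp only [map_add, map_sub]
  rw [mul_comm y x, mul_comm z x, t (mulL x * mulL z) (mulL y),
    t (mulL y * mulL z) (mulL x), ← mul_assoc, ← mul_assoc, t (mulL x * mulL y) (mulL z),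
    ← mul_assoc]
  ring

theorem traceForm_nondegenerate : (traceForm V).Nondegenerate := by
  refine LinearMap.IsRefl.nondegenerate_iff_separatingLeft ?_ |>.2 ?_
  · intro x y h; rw [traceForm_comm, h]
  · intro x h
    by_contra hx
    exact (EuclideanJordanAlgebra.traceForm_pos x hx).ne' (h x)

/-- A Euclidean Jordan algebra has an identity element. -/
theorem exists_unit : ∃ e : V, ∀ x : V, e * x = x := by
  let f : Module.Dual ℝ V := (LinearMap.trace ℝ V).comp (LinearMap.mul ℝ V)
  let e := ((traceForm V).toDual traceForm_nondegenerate).symm f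
  have he : ∀ y, traceForm V e y = LinearMap.trace ℝ V (mulL y) := fun y =>
    LinearMap.BilinForm.apply_toDual_symm_apply (hB := traceForm_nondegenerate) f y
  refine ⟨e, fun x => ?_⟩
  have hw : ∀ u, traceForm V (e * x - x) u = 0 := fun u => by
    rw [map_sub, LinearMap.sub_apply, traceForm_assoc, he, traceForm_apply, sub_self]
  exact sub_eq_zero.1 (traceForm_nondegenerate.1 _ hw)

variable (V) in
/-- The identity element `e`. -/
def unit : V := (exists_unit (V := V)).choose

theorem unit_mul (x : V) : unit V * x = x := (exists_unit (V := V)).choose_spec x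

/-- The value `p(x)` of a real polynomial at `x`, where `x ^ 0 = e` and
`x ^ (k + 1) = x * x ^ k`, that is, `x ^ k = L(x) ^ k e`. -/
def evalAt (x : V) (p : ℝ[X]) : V := aeval (mulL x) p (unit V)

/-- The ideal of all real polynomials that vanish at `x`. -/
def annIdeal (x : V) : Ideal ℝ[X] where
  carrier := {p | evalAt x p = 0}
  zero_mem' := by simp [evalAt]
  add_mem' {p q} hp hq := by
    simp only [Set.mem_ofPred_eq, evalAt] at hp hq ⊢
    simp [hp, hq]
  smul_mem' c p hp := by
    simp only [Set.mem_ofPred_eq, evalAt] at hp ⊢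
    simp [Module.End.mul_apply, hp]

/-- The minimal polynomial `f_x` of `x`: the monic generator of the annihilating ideal. -/
def minPoly (x : V) : ℝ[X] := normalize (Submodule.IsPrincipal.generator (annIdeal x))

variable (V) in
/-- The rank `r`: the largest degree of a minimal polynomial. -/
def rank : ℕ := ⨆ x : V, (minPoly x).natDegree

/-- `x` is regular if its minimal polynomial has the largest possible degree `r`. -/
def IsRegular (x : V) : Prop := (minPoly x).natDegree = rank V

/-- `x` is invertible if `x * y = e` for some `y` in the subalgebra `ℝ[x]` of polynomials
in `x`. -/
def IsInvertible (x : V) : Prop := ∃ p : ℝ[X], x * evalAt x p = unit V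

variable (V) in
/-- The symmetric cone `Ω = {x² | x invertible}`. -/
def cone : Set V := {y | ∃ x : V, IsInvertible x ∧ y = x * x}

variable (V) in
/-- The positive definite form `β` as an inner product. -/
@[reducible] def innerCore : InnerProductSpace.Core ℝ V where
  inner x y := traceForm V x y
  conj_inner_symm x y := by simp [traceForm_comm x y]
  re_inner_nonneg x := by
    rcases eq_or_ne x 0 with rfl | hx
    · simp
    · simpa using (EuclideanJordanAlgebra.traceForm_pos x hx).le
  add_left x y z := by simp
  smul_left x y r := by simp
  definite x hx := by
    by_contra h
    exact (EuclideanJordanAlgebra.traceForm_pos x h).ne' hx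

/-- A Euclidean Jordan algebra is a Euclidean vector space under the inner product `β`; this
fixes its topology and its Lebesgue measure `volume`. -/
instance (priority := 50) instNormedAddCommGroup : NormedAddCommGroup V :=
  (innerCore V).toNormedAddCommGroup

instance (priority := 50) instInnerProductSpace : InnerProductSpace ℝ V :=
  InnerProductSpace.ofCore (innerCore V).toCore

/-- The Jordan determinant `Δ`. At a regular `x`, where
`f_x(λ) = λ ^ r - a₁(x) λ ^ (r - 1) + ⋯ + (-1) ^ r a_r(x)`, it is `a_r(x)`; it is extended by
continuity from the dense set of regular elements to the whole algebra. -/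
def jdet : V → ℝ := extendFrom {x | IsRegular x} fun x => (-1) ^ rank V * (minPoly x).coeff 0

variable (V) in
/-- The tube domain `T_Ω = V + iΩ` in the complexification `ℂ ⊗ V`. -/
def tube : Set (ℂ ⊗[ℝ] V) := {z | ∃ x : V, ∃ y ∈ cone V, z = 1 ⊗ₜ[ℝ] x + Complex.I ⊗ₜ[ℝ] y}

/-- The square norm
`‖F‖_ν² = ∫_{T_Ω} |F(x + iy)|² Δ(y) ^ (ν - 2n/r) dx dy`, with values in `[0, ∞]`. -/
def bergmanNormSq [MeasurableSpace V] [BorelSpace V] (ν : ℝ) (F : ℂ ⊗[ℝ] V → ℂ) : ENNReal :=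
  ∫⁻ p in (Set.univ : Set V) ×ˢ cone V,
    ENNReal.ofReal (‖F (1 ⊗ₜ[ℝ] p.1 + Complex.I ⊗ₜ[ℝ] p.2)‖ ^ 2 *
      jdet p.2 ^ (ν - 2 * (Module.finrank ℝ V : ℝ) / (rank V : ℝ)))
    ∂((volume : Measure V).prod (volume : Measure V))

/-- `F` (restricted to `T_Ω`) belongs to the weighted Bergman space `H²_ν(T_Ω)`. -/
def MemBergman [MeasurableSpace V] [BorelSpace V] (ν : ℝ) (F : ℂ ⊗[ℝ] V → ℂ) : Prop :=
  DifferentiableOn ℂ F (tube V) ∧ bergmanNormSq ν F < ⊤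

end Algebra

end EJA

end

noncomputable section

set_option linter.unusedSectionVars false

namespace EJA

variable {V : Type*} [NonUnitalNonAssocCommRing V] [Module ℝ V]
  [IsScalarTower ℝ V V] [SMulCommClass ℝ V V] [EuclideanJordanAlgebra V]

/-! If |F₂(x+iy)|² ≤ K Δ(y)^(-ν₂) on the tube, then multiplying by |F₁|² Δ(y)^(ν₁+ν₂-2n/r) and
integrating bounds the square norm of F₁F₂ by K‖F₁‖². Everything rests on this pointwise bound,
`MemBergman.exists_bound`.

The bound is the mean value inequality on a small ball about ie, made uniform by homogeneity. Each
exp L(h) preserves Ω (`flow_mem_cone`), and every y in Ω is exp L(h) e for some h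
(`exists_flow_unit_eq`), so z ↦ x + exp L(h) z carries the ball to a neighbourhood of x+iy. Its
Jacobian det(exp L(h))² is Δ(y)^(2n/r) (`det_flow_sq_eq`), and it multiplies Δ of the imaginary part
by Δ(y) (`jdet_flow`).

Both rules follow from Δ^(2n/r) = det P on Ω (`jdet_eq`), where P(x) = 2L(x)² - L(x²), because P(exp
L(h) w) = exp L(h) P(w) exp L(h). The formula for Δ is a computation in a frame of primitive
idempotents: simplicity forces all of them to have the same trace n/r (`IsFrame.trace_eq`). It is
checked at regular points, which are dense. -/

theorem mulL_mul_mul (a b d : V) : mulL (a * b * d)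
    = mulL (a * d) * mulL b + mulL (b * d) * mulL a + mulL (a * b) * mulL d
      - mulL a * mulL d * mulL b - mulL b * mulL d * mulL a := by
  ext w
  simp only [LinearMap.add_apply, LinearMap.sub_apply, Module.End.mul_apply, mulL_apply]
  rw [← jordan_linearized a b d w]
  abel

theorem mulL_add (x y : V) : mulL (x + y) = mulL x + mulL y := map_add (LinearMap.mul ℝ V) x y

theorem mulL_smul (a : ℝ) (x : V) : mulL (a • x) = a • mulL x := map_smul (LinearMap.mul ℝ V) a x

theorem mulL_zero : mulL (0 : V) = 0 := map_zero (LinearMap.mul ℝ V)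

theorem mulL_sum {ι : Type*} (s : Finset ι) (f : ι → V) :
    mulL (∑ i ∈ s, f i) = ∑ i ∈ s, mulL (f i) := map_sum (LinearMap.mul ℝ V) f s

theorem mulL_unit : mulL (unit V) = 1 := by
  ext x; simp [mulL_apply, unit_mul]

theorem mul_unit (x : V) : x * unit V = x := by rw [mul_comm, unit_mul]

theorem commute_mulL_mul_self (x : V) : Commute (mulL x) (mulL (x * x)) := by
  ext w
  have := IsCommJordan.lmul_comm_rmul_rmul x w
  simp only [Module.End.mul_apply, mulL_apply]
  rw [mul_comm (x * x) w, ← this, mul_comm]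

theorem traceForm_mul_left (x y z : V) : traceForm V (x * y) z = traceForm V y (x * z) := by
  rw [mul_comm x y, traceForm_assoc]

/-! ### Power associativity -/

theorem evalAt_add (x : V) (p q : ℝ[X]) : evalAt x (p + q) = evalAt x p + evalAt x q := by
  simp [evalAt]

theorem evalAt_X (x : V) : evalAt x X = x := by
  simp [evalAt, mulL_apply, mul_unit]

theorem evalAt_C (x : V) (a : ℝ) : evalAt x (C a) = a • unit V := by
  simp [evalAt, Module.algebraMap_end_apply]

/-- The linearized Jordan identity writes L(x^(k+2)) in terms of L(x), L(x²), L(x^k) and L(x^(k+1)),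
whence the two-step induction. -/
theorem commute_mulL_pow (x : V) (k : ℕ) :
    Commute (mulL x) (mulL ((mulL x ^ k) (unit V))) := by
  induction k using Nat.twoStepInduction with
  | zero => simp [mulL_unit]
  | one => simp [mulL_apply, mul_unit]
  | more k h1 h2 =>
    have e : (mulL x ^ (k + 2)) (unit V) = (mulL x ^ k) (unit V) * x * x := by
      rw [pow_succ', pow_succ', Module.End.mul_apply, Module.End.mul_apply, mulL_apply, mulL_apply,
        mul_comm, mul_comm x ((mulL x ^ k) _)]
    have e1 : (mulL x ^ (k + 1)) (unit V) = (mulL x ^ k) (unit V) * x := by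
      rw [pow_succ', Module.End.mul_apply, mulL_apply, mul_comm]
    rw [e1] at h2
    have h3 := commute_mulL_mul_self x
    have h4 := Commute.refl (mulL x)
    rw [e, mulL_mul_mul]
    exact ((((h2.mul_right h4).add_right (h3.mul_right h1)).add_right (h2.mul_right h4)).sub_right
      ((h1.mul_right h4).mul_right h4)).sub_right ((h4.mul_right h4).mul_right h1)

theorem commute_mulL_evalAt (x : V) (p : ℝ[X]) : Commute (mulL x) (mulL (evalAt x p)) := by
  induction p using Polynomial.induction_on' with
  | add p q hp hq => rw [evalAt_add, mulL_add]; exact hp.add_right hq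
  | monomial k a =>
    have : evalAt x (monomial k a) = a • (mulL x ^ k) (unit V) := by
      simp [evalAt, aeval_monomial, Module.algebraMap_end_apply]
    rw [this, mulL_smul]
    exact (commute_mulL_pow x k).smul_right a

/-- Power associativity: q(L(x)) commutes with L(p(x)), and applying both orders to e gives the
claim. -/
theorem evalAt_mul (x : V) (p q : ℝ[X]) : evalAt x (p * q) = evalAt x p * evalAt x q := by
  have h : Commute (aeval (mulL x) q) (mulL (evalAt x p)) := by
    induction q using Polynomial.induction_on' with
    | add p q hp hq => rw [map_add]; exact hp.add_left hq
    | monomial k a =>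
      rw [aeval_monomial]
      exact Commute.mul_left (Algebra.commutes a _) ((commute_mulL_evalAt x p).pow_left k)
  have := LinearMap.congr_fun h.eq (unit V)
  simp only [Module.End.mul_apply, mulL_apply, mul_unit] at this
  rw [mul_comm p q]
  simpa [evalAt, Module.End.mul_apply] using this

/-! ### Systems of orthogonal idempotents -/

/-- A complete system of nonzero orthogonal idempotents. -/
structure IsFrame {ι : Type*} (s : Finset ι) (c : ι → V) : Prop where
  mul_self : ∀ i ∈ s, c i * c i = c i
  mul_ne : ∀ i ∈ s, ∀ j ∈ s, i ≠ j → c i * c j = 0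
  ne_zero : ∀ i ∈ s, c i ≠ 0
  sum_eq : ∑ i ∈ s, c i = unit V

namespace IsFrame

variable {ι : Type*} {s : Finset ι} {c : ι → V}

theorem sum_smul_mul (h : IsFrame s c) (m : ι → ℝ) {j : ι} (hj : j ∈ s) :
    (∑ i ∈ s, m i • c i) * c j = m j • c j := by
  rw [Finset.sum_mul, Finset.sum_eq_single_of_mem j hj, smul_mul_assoc, h.mul_self j hj]
  intro i hi hij
  rw [smul_mul_assoc, h.mul_ne i hi j hj hij, smul_zero]

theorem aeval_mulL_apply_of_mul_eq {x v : V} {a : ℝ} (h : x * v = a • v) (p : ℝ[X]) :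
    aeval (mulL x) p v = p.eval a • v :=
  Module.End.aeval_apply_of_mem_apply_eq_smul h

/-- The value of a polynomial at `∑ i, m i • c i`. -/
theorem evalAt_sum (h : IsFrame s c) (m : ι → ℝ) (p : ℝ[X]) :
    evalAt (∑ i ∈ s, m i • c i) p = ∑ i ∈ s, p.eval (m i) • c i := by
  rw [evalAt]
  conv_lhs => rw [← h.sum_eq]
  rw [map_sum]
  exact Finset.sum_congr rfl fun i hi => aeval_mulL_apply_of_mul_eq (h.sum_smul_mul m hi) p

theorem eq_zero_of_sum_eq_zero (h : IsFrame s c) {m : ι → ℝ} (hm : ∑ i ∈ s, m i • c i = 0) :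
    ∀ i ∈ s, m i = 0 := by
  intro i hi
  have := h.sum_smul_mul m hi
  rw [hm, zero_mul] at this
  exact (smul_eq_zero.1 this.symm).resolve_right (h.ne_zero i hi)

theorem eq_of_sum_eq (h : IsFrame s c) {m m' : ι → ℝ}
    (hm : ∑ i ∈ s, m i • c i = ∑ i ∈ s, m' i • c i) : ∀ i ∈ s, m i = m' i := by
  intro i hi
  refine sub_eq_zero.1 (h.eq_zero_of_sum_eq_zero (m := fun i => m i - m' i) ?_ i hi)
  simp [sub_smul, hm]

theorem card_le (h : IsFrame s c) : s.card ≤ Module.finrank ℝ V := by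
  have : LinearIndependent ℝ (fun i : s => c i) := by
    rw [Fintype.linearIndependent_iff]
    intro g hg i
    classical
    have := h.eq_zero_of_sum_eq_zero (m := fun i => if hi : i ∈ s then g ⟨i, hi⟩ else 0)
      (by rw [← Finset.sum_coe_sort]; simpa using hg) i i.2
    simpa using this
  simpa using this.fintype_card_le_finrank

end IsFrame

/-! ### The spectral theorem -/

theorem inner_eq_traceForm (x y : V) : inner ℝ x y = traceForm V x y := rfl

theorem isSymmetric_mulL (x : V) : (mulL x).IsSymmetric := fun y z =>
  traceForm_mul_left x y z

theorem exists_finset_prod_apply_eq_zero (x : V) :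
    ∃ s : Finset ℝ, ∀ v : V, aeval (mulL x) (∏ a ∈ s, (X - C a)) v = 0 := by
  classical
  let b := (isSymmetric_mulL x).eigenvectorBasis rfl
  let s := Finset.univ.image ((isSymmetric_mulL x).eigenvalues rfl)
  refine ⟨s, fun v => ?_⟩
  have : aeval (mulL x) (∏ a ∈ s, (X - C a)) = 0 := by
    refine b.toBasis.ext fun i => ?_
    have hb : mulL x (b.toBasis i) = (isSymmetric_mulL x).eigenvalues rfl i • b.toBasis i := by
      simp [b]
    rw [Module.End.aeval_apply_of_mem_apply_eq_smul hb, LinearMap.zero_apply, eval_prod,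
      Finset.prod_eq_zero (i := (isSymmetric_mulL x).eigenvalues rfl i), zero_smul]
    · simp [s]
    · simp
  rw [this, LinearMap.zero_apply]

/-- The spectral theorem: every element is a combination, with distinct coefficients, of a
complete system of orthogonal idempotents. -/
theorem exists_isFrame (x : V) :
    ∃ (s : Finset ℝ) (c : ℝ → V), IsFrame s c ∧ x = ∑ a ∈ s, a • c a := by
  classical
  obtain ⟨s, hs⟩ := exists_finset_prod_apply_eq_zero x
  -- The spectral idempotents are the Lagrange basis polynomials of the eigenvalues of L(x),
  -- evaluated at x.
  let l : ℝ → ℝ[X] := Lagrange.basis s id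
  let c : ℝ → V := fun a => evalAt x (l a)
  have hinj : Set.InjOn (id : ℝ → ℝ) s := Function.injective_id.injOn
  have hx : ∀ a ∈ s, x * c a = a • c a := by
    intro a ha
    have h1 : (∏ b ∈ s, (X - C b)) ∣ (X - C a) * l a := by
      rw [← Finset.mul_prod_erase s _ ha]
      refine mul_dvd_mul_left _ ?_
      rw [show l a = ∏ j ∈ s.erase a, Lagrange.basisDivisor a j from rfl]
      refine Finset.prod_dvd_prod_of_dvd _ _ fun j _ => Dvd.intro_left _ rfl
    obtain ⟨q, hq⟩ := h1
    have h2 : evalAt x ((X - C a) * l a) = 0 := by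
      rw [hq, evalAt, map_mul, Module.End.mul_apply, hs]
    rw [evalAt_mul, sub_eq_add_neg, evalAt_add, evalAt_X, ← C_neg, evalAt_C, neg_smul, add_mul,
      neg_mul, smul_mul_assoc, unit_mul] at h2
    exact add_neg_eq_zero.1 h2
  have hmul : ∀ a ∈ s, ∀ b, c b * c a = (l b).eval a • c a := by
    intro a ha b
    rw [← IsFrame.aeval_mulL_apply_of_mul_eq (hx a ha), ← evalAt_mul]
    simp [evalAt, c, Module.End.mul_apply]
  have hsum : ∑ a ∈ s, c a = unit V := by
    rcases s.eq_empty_or_nonempty with rfl | hne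
    · simpa using (hs (unit V)).symm
    · have := Lagrange.sum_basis hinj hne
      rw [← one_smul ℝ (unit V), ← evalAt_C x, C_1, ← this]
      simp [evalAt, c, l]
  have hfil : ∀ f : ℝ → ℝ, ∑ a ∈ s with c a ≠ 0, f a • c a = ∑ a ∈ s, f a • c a := by
    intro f
    refine Finset.sum_filter_of_ne fun a _ h h' => h (by rw [h', smul_zero])
  -- L(x) can have eigenvalues that are not spectral values of x, such as midpoints of two of them;
  -- there `c a` vanishes and is discarded.
  refine ⟨s.filter fun a => c a ≠ 0, c, ⟨?_, ?_, ?_, ?_⟩, ?_⟩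
  · intro a ha
    have ha := (Finset.mem_filter.1 ha).1
    rw [hmul a ha a, show (l a).eval a = 1 from Lagrange.eval_basis_self hinj ha, one_smul]
  · intro a ha b hb hab
    have hb := (Finset.mem_filter.1 hb).1
    rw [hmul b hb a, show (l a).eval b = 0 from
      Lagrange.eval_basis_of_ne (v := id) hab hb, zero_smul]
  · intro a ha; exact (Finset.mem_filter.1 ha).2
  · simpa using (hfil fun _ => 1).trans (by simpa using hsum)
  · rw [hfil fun a => a]
    conv_lhs => rw [← mul_unit x, ← hsum, Finset.mul_sum]
    exact Finset.sum_congr rfl hx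

/-! ### Minimal polynomials and the rank -/

theorem IsFrame.evalAt_eq_zero_iff {s : Finset ℝ} {c : ℝ → V} (h : IsFrame s c) (p : ℝ[X]) :
    evalAt (∑ a ∈ s, a • c a) p = 0 ↔ ∀ a ∈ s, p.eval a = 0 := by
  rw [h.evalAt_sum]
  refine ⟨fun hp => h.eq_zero_of_sum_eq_zero hp, fun hp => Finset.sum_eq_zero fun a ha => ?_⟩
  rw [hp a ha, zero_smul]

theorem IsFrame.minPoly_eq {s : Finset ℝ} {c : ℝ → V} (h : IsFrame s c) :
    minPoly (∑ a ∈ s, a • c a) = ∏ a ∈ s, (X - C a) := by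
  set x := ∑ a ∈ s, a • c a
  set g := Submodule.IsPrincipal.generator (annIdeal x)
  have hmem : ∀ p : ℝ[X], p ∈ annIdeal x ↔ ∀ a ∈ s, p.eval a = 0 := h.evalAt_eq_zero_iff
  have h1 : g ∣ ∏ a ∈ s, (X - C a) := by
    rw [← Submodule.IsPrincipal.mem_iff_generator_dvd, hmem]
    intro a ha
    rw [eval_prod]
    exact Finset.prod_eq_zero ha (by simp)
  have h2 : ∏ a ∈ s, (X - C a) ∣ g := by
    refine Finset.prod_dvd_of_coprime ?_ fun a ha => ?_
    · intro a _ b _ hab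
      exact Polynomial.isCoprime_X_sub_C_of_isUnit_sub (sub_ne_zero.2 hab).isUnit
    · rw [dvd_iff_isRoot]
      exact (hmem g).1 (Submodule.IsPrincipal.generator_mem _) a ha
  have := normalize_eq_normalize h1 h2
  rw [minPoly, this, (monic_prod_of_monic _ _ fun a _ => monic_X_sub_C a).normalize_eq_self]

theorem IsFrame.natDegree_minPoly {s : Finset ℝ} {c : ℝ → V} (h : IsFrame s c) :
    (minPoly (∑ a ∈ s, a • c a)).natDegree = s.card := by
  rw [h.minPoly_eq, natDegree_prod_of_monic _ _ fun a _ => monic_X_sub_C a]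
  simp

/-- Without a bound the supremum defining `rank` would take its default value 0. A frame is linearly
independent, so dim V is a bound. -/
theorem bddAbove_natDegree_minPoly : BddAbove (Set.range fun x : V => (minPoly x).natDegree) := by
  refine ⟨Module.finrank ℝ V, ?_⟩
  rintro _ ⟨x, rfl⟩
  obtain ⟨s, c, h, rfl⟩ := exists_isFrame x
  exact h.natDegree_minPoly.trans_le h.card_le

theorem natDegree_minPoly_le_rank (x : V) : (minPoly x).natDegree ≤ rank V :=
  le_ciSup bddAbove_natDegree_minPoly x

theorem minPoly_monic (x : V) : (minPoly x).Monic := by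
  obtain ⟨s, c, h, rfl⟩ := exists_isFrame x
  rw [h.minPoly_eq]
  exact monic_prod_of_monic _ _ fun a _ => monic_X_sub_C a

theorem evalAt_minPoly (x : V) : evalAt x (minPoly x) = 0 := by
  obtain ⟨s, c, h, rfl⟩ := exists_isFrame x
  rw [h.evalAt_eq_zero_iff, h.minPoly_eq]
  intro a ha
  rw [eval_prod]
  exact Finset.prod_eq_zero ha (by simp)

variable (V) in
theorem exists_isRegular : ∃ x : V, IsRegular x :=
  Set.mem_range.1 (Nat.sSup_mem (Set.range_nonempty _) bddAbove_natDegree_minPoly)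

theorem traceForm_self_nonneg (x : V) : 0 ≤ traceForm V x x := by
  rcases eq_or_ne x 0 with rfl | hx
  · simp
  · exact (EuclideanJordanAlgebra.traceForm_pos x hx).le

theorem eq_zero_of_traceForm_self {x : V} (h : traceForm V x x = 0) : x = 0 := by
  by_contra hx
  exact (EuclideanJordanAlgebra.traceForm_pos x hx).ne' h

/-! ### Peirce decomposition -/

section Peirce

variable {c : V}

/-- The Peirce equation: L(c) is annihilated by t(2t-1)(t-1), so its only possible eigenvalues are
0, 1/2 and 1. -/
theorem idem_cubic (hc : c * c = c) (v : V) :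
    c * v = (3 : ℝ) • (c * (c * v)) - (2 : ℝ) • (c * (c * (c * v))) := by
  have h := LinearMap.congr_fun (mulL_mul_mul c c c) v
  simp only [hc, LinearMap.add_apply, LinearMap.sub_apply, Module.End.mul_apply, mulL_apply] at h
  conv_lhs => rw [h]
  module

theorem traceForm_idem_mul_nonneg (hc : c * c = c) (v : V) : 0 ≤ traceForm V (c * v) v := by
  have h3 := idem_cubic hc v
  have e1 : traceForm V (c * v) v = 3 * traceForm V (c * v) (c * v)
      - 2 * traceForm V (c * v) (c * (c * v)) := by
    conv_lhs => rw [h3]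
    rw [map_sub, map_smul, map_smul, LinearMap.sub_apply, LinearMap.smul_apply,
      LinearMap.smul_apply, traceForm_mul_left, traceForm_mul_left c (c * (c * v)),
      traceForm_comm (c * (c * v))]
    simp
  have e2 : traceForm V (c * v) (c * v) = 3 * traceForm V (c * v) (c * (c * v))
      - 2 * traceForm V (c * (c * v)) (c * (c * v)) := by
    conv_lhs => enter [2]; rw [h3]
    rw [map_sub, map_smul, map_smul, ← traceForm_mul_left c (c * v) (c * (c * v))]
    simp
  -- With A = L(c), the cubic gives β(Av, v) = 8‖(A-A²)v‖² + ‖(2A²-A)v‖²: the first operator is 1/4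
  -- on the half space and 0 elsewhere, the second is 1 on the 1-space and 0 elsewhere.
  have p1 := traceForm_self_nonneg (c * v - c * (c * v))
  have p2 := traceForm_self_nonneg ((2 : ℝ) • (c * (c * v)) - c * v)
  simp only [map_sub, LinearMap.sub_apply, map_smul, LinearMap.smul_apply, smul_eq_mul,
    traceForm_comm (c * (c * v)) (c * v)] at p1 p2
  linarith

theorem half_mul_half (hc : c * c = c) {x : V} (hx : c * x = (1 / 2 : ℝ) • x) :
    c * (c * (x * x)) = c * (x * x) := by
  have h := jordan_linearized x x c c
  rw [mul_comm x c, hx, hc, mul_comm (x * x) c, mul_comm _ c] at h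
  simp only [mul_smul_comm, smul_mul_assoc, hx] at h
  have h2 : c * (c * (x * x)) - c * (x * x) = 0 := by
    linear_combination (norm := module) h
  exact sub_eq_zero.1 h2

/-- The linearized identity gives (A² - A + 1)(ab) = 0 for A = L(c), and t² - t + 1 has no root
among 0, 1/2, 1. -/
theorem one_mul_zero (hc : c * c = c) {a b : V} (ha : c * a = a) (hb : c * b = 0) :
    a * b = 0 := by
  have h := LinearMap.congr_fun (mulL_mul_mul a c c) b
  simp only [hc, mul_comm a c, ha, LinearMap.add_apply, LinearMap.sub_apply, Module.End.mul_apply,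
    mulL_apply, hb, mul_zero, zero_add, sub_zero, add_zero] at h
  have h3 := idem_cubic hc (a * b)
  have h4 := congrArg (c * ·) h
  simp only [mul_sub] at h4
  have h5 := congrArg (c * ·) h4
  simp only [mul_sub] at h5
  have h6 := congrArg (c * ·) h3
  simp only [mul_sub, mul_smul_comm] at h6
  -- The coefficients are a Bézout relation between t² - t + 1 and 2t³ - 3t² + t.
  linear_combination (norm := module) h - (1 / 3 : ℝ) • h3 + (4 / 3 : ℝ) • h4
    - (4 / 3 : ℝ) • h5 + (2 / 3 : ℝ) • h6

/-- The defect w = ab - c(ab) is killed by c, so aw = 0 by `one_mul_zero`; associativity of β then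
makes w orthogonal to itself. -/
theorem one_mul_one (hc : c * c = c) {a b : V} (ha : c * a = a) (hb : c * b = b) :
    c * (a * b) = a * b := by
  have h := LinearMap.congr_fun (mulL_mul_mul a c c) b
  simp only [hc, mul_comm a c, ha, LinearMap.add_apply, LinearMap.sub_apply, Module.End.mul_apply,
    mulL_apply, hb] at h
  have h1 : c * (a * b - c * (a * b)) = 0 := by
    rw [mul_sub]
    linear_combination (norm := module) (-1 : ℝ) • h
  refine (sub_eq_zero.1 (eq_zero_of_traceForm_self ?_)).symm
  rw [map_sub, ← traceForm_mul_left c, h1, map_zero, LinearMap.zero_apply, sub_zero,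
    traceForm_comm, traceForm_mul_left, one_mul_zero hc ha h1, map_zero]

variable {d : V}

theorem orthogonal_mul_mul (hc : c * c = c) (hcd : c * d = 0) (x : V) :
    c * (d * x) = (2 : ℝ) • (c * (d * (c * x))) := by
  have h := LinearMap.congr_fun (mulL_mul_mul c c d) x
  simp only [hc, hcd, mulL_zero, LinearMap.add_apply, LinearMap.sub_apply, Module.End.mul_apply,
    mulL_apply, LinearMap.zero_apply, zero_add] at h
  linear_combination (norm := module) -h

/-- By `orthogonal_mul_mul`, L(c)L(d) = 2L(c)L(d)L(c). The right side is self-adjoint, hence so is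
the left, and its adjoint is L(d)L(c). -/
theorem orthogonal_commute (hc : c * c = c) (hcd : c * d = 0) (x : V) :
    c * (d * x) = d * (c * x) := by
  refine sub_eq_zero.1 (traceForm_nondegenerate.1 _ fun y => ?_)
  rw [map_sub, LinearMap.sub_apply, sub_eq_zero, orthogonal_mul_mul hc hcd, map_smul,
    LinearMap.smul_apply, traceForm_mul_left, traceForm_mul_left, traceForm_mul_left,
    traceForm_mul_left d, traceForm_mul_left c, orthogonal_mul_mul hc hcd y, map_smul]

theorem orthogonal_mul_half (hc : c * c = c) (hcd : c * d = 0) (x : V) :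
    c * (c * (d * x)) = (1 / 2 : ℝ) • (c * (d * x)) := by
  have h := orthogonal_mul_mul hc hcd x
  rw [← orthogonal_commute hc hcd x] at h
  linear_combination (norm := module) (-(1 / 2) : ℝ) • h

end Peirce

/-! ### The symmetric cone -/

namespace IsFrame

variable {ι : Type*} {s : Finset ι} {c : ι → V}

/-- The numbers β(c_i v, v) are nonnegative and sum to β(v, v) > 0, so one of them is positive. -/
theorem traceForm_mul_pos (h : IsFrame s c) {m : ι → ℝ} (hm : ∀ i ∈ s, 0 < m i) {v : V}
    (hv : v ≠ 0) : 0 < traceForm V ((∑ i ∈ s, m i • c i) * v) v := by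
  have e : ∀ m : ι → ℝ, traceForm V ((∑ i ∈ s, m i • c i) * v) v
      = ∑ i ∈ s, m i * traceForm V (c i * v) v := by
    intro m
    simp [Finset.sum_mul, map_sum, LinearMap.sum_apply, smul_mul_assoc]
  have h0 : ∀ i ∈ s, 0 ≤ traceForm V (c i * v) v := fun i hi =>
    traceForm_idem_mul_nonneg (h.mul_self i hi) v
  have h1 := e fun _ => 1
  simp only [one_smul, h.sum_eq, unit_mul, one_mul] at h1
  have h2 : 0 < ∑ i ∈ s, traceForm V (c i * v) v :=
    h1 ▸ EuclideanJordanAlgebra.traceForm_pos v hv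
  obtain ⟨i, hi, hpos⟩ := (Finset.sum_pos_iff_of_nonneg h0).1 h2
  rw [e]
  exact Finset.sum_pos' (fun j hj => mul_nonneg (hm j hj).le (h0 j hj))
    ⟨i, hi, mul_pos (hm i hi) hpos⟩

theorem coeff_pos (h : IsFrame s c) {m : ι → ℝ}
    (hpos : ∀ v : V, v ≠ 0 → 0 < traceForm V ((∑ i ∈ s, m i • c i) * v) v) :
    ∀ i ∈ s, 0 < m i := by
  intro i hi
  have := hpos (c i) (h.ne_zero i hi)
  rw [h.sum_smul_mul m hi, map_smul, LinearMap.smul_apply, smul_eq_mul] at this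
  exact pos_of_mul_pos_left this (traceForm_self_nonneg _)

theorem sum_mul_sum (h : IsFrame s c) (m m' : ι → ℝ) :
    (∑ i ∈ s, m i • c i) * (∑ i ∈ s, m' i • c i) = ∑ i ∈ s, (m i * m' i) • c i := by
  rw [Finset.mul_sum]
  refine Finset.sum_congr rfl fun i hi => ?_
  rw [mul_smul_comm, h.sum_smul_mul m hi, smul_smul, mul_comm]

end IsFrame

/-- The symmetric cone consists of the elements with positive definite multiplication operator. -/
theorem mem_cone_iff {y : V} :
    y ∈ cone V ↔ ∀ v : V, v ≠ 0 → 0 < traceForm V (y * v) v := by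
  constructor
  · rintro ⟨x, ⟨p, hp⟩, rfl⟩
    obtain ⟨s, c, h, rfl⟩ := exists_isFrame x
    intro v hv
    rw [h.sum_mul_sum]
    refine h.traceForm_mul_pos (fun a ha => mul_self_pos.2 fun h0 => ?_) hv
    rw [h.evalAt_sum, h.sum_mul_sum, ← h.sum_eq] at hp
    have := h.eq_of_sum_eq (m' := fun _ => 1) (by simpa using hp) a ha
    simp [h0] at this
  · intro hy
    obtain ⟨s, c, h, rfl⟩ := exists_isFrame y
    have hpos := h.coeff_pos hy
    -- Invertibility asks for an inverse in ℝ[x]. For the square root x of y it comes from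
    -- interpolating the reciprocal at the distinct nodes √a.
    have hinj : Set.InjOn (fun a : ℝ => √a) s := fun a ha b hb hab =>
      (Real.sqrt_inj (hpos a ha).le (hpos b hb).le).1 hab
    refine ⟨∑ a ∈ s, √a • c a,
      ⟨Lagrange.interpolate s (fun a => √a) fun a => (√a)⁻¹, ?_⟩, ?_⟩
    · rw [h.evalAt_sum, h.sum_mul_sum, ← h.sum_eq]
      refine Finset.sum_congr rfl fun a ha => ?_
      rw [Lagrange.eval_interpolate_at_node _ hinj ha,
        mul_inv_cancel₀ (Real.sqrt_pos.2 (hpos a ha)).ne', one_smul]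
    · rw [h.sum_mul_sum]
      exact Finset.sum_congr rfl fun a ha => by rw [Real.mul_self_sqrt (hpos a ha).le]

theorem unit_mem_cone : unit V ∈ cone V :=
  mem_cone_iff.2 fun v hv => by rw [unit_mul]; exact EuclideanJordanAlgebra.traceForm_pos v hv

/-! ### Primitive idempotents -/

/-- The idempotents of the frame of a regular element are primitive. -/
theorem IsFrame.exists_eq_smul {s : Finset ℝ} {c : ℝ → V} (h : IsFrame s c)
    (hs : s.card = rank V) {i : ℝ} (hi : i ∈ s) {z : V} (hz : c i * z = z) :
    ∃ a : ℝ, z = a • c i := by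
  classical
  obtain ⟨S, hS⟩ := exists_finset_prod_apply_eq_zero z
  -- The shift t is generic: no j - t with j in `s` is an eigenvalue of L(z).
  obtain ⟨t, ht⟩ := Infinite.exists_notMem_finset (Finset.image₂ (fun j a => j - a) s S)
  have hci := h.mul_self i hi
  have hinj : ∀ j ∈ s, ∀ v : V, z * v = (j - t) • v → v = 0 := by
    intro j hj v hv
    have := hS v
    rw [IsFrame.aeval_mulL_apply_of_mul_eq hv, eval_prod] at this
    refine (smul_eq_zero.1 this).resolve_left (Finset.prod_ne_zero_iff.2 fun a ha h0 => ht ?_)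
    rw [Finset.mem_image₂]
    refine ⟨j, hj, a, ha, ?_⟩
    simp at h0
    linarith
  -- In the regular element, i c_i is replaced by z + t c_i. The minimal polynomial of y already has
  -- the r - 1 roots j ≠ i and has degree at most r, which leaves a factor of degree at most 1 to
  -- annihilate c_i.
  set y := ∑ j ∈ s.erase i, j • c j + (z + t • c i)
  have hyj : ∀ j ∈ s.erase i, y * c j = j • c j := by
    intro j hj
    have hj' := Finset.mem_erase.1 hj
    have h1 : z * c j = 0 := one_mul_zero hci hz (h.mul_ne i hi j hj'.2 hj'.1.symm)
    rw [add_mul, add_mul, h1, smul_mul_assoc, h.mul_ne i hi j hj'.2 hj'.1.symm, Finset.sum_mul,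
      Finset.sum_eq_single_of_mem j hj, smul_mul_assoc, h.mul_self j hj'.2]
    · simp
    · intro k hk hkj
      rw [smul_mul_assoc, h.mul_ne k (Finset.mem_of_mem_erase hk) j hj'.2 hkj, smul_zero]
  have hyv : ∀ v, c i * v = v → y * v = z * v + t • v := by
    intro v hv
    rw [add_mul, Finset.sum_mul, Finset.sum_eq_zero, zero_add, add_mul, smul_mul_assoc, hv]
    intro k hk
    have hk' := Finset.mem_erase.1 hk
    rw [smul_mul_assoc, mul_comm, one_mul_zero hci hv (h.mul_ne i hi k hk'.2 hk'.1.symm), smul_zero]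
  have hinv : ∀ v, c i * v = v → c i * (y * v) = y * v := by
    intro v hv
    rw [hyv v hv, mul_add, mul_smul_comm, hv, one_mul_one hci hz hv]
  have hinv' : ∀ p : ℝ[X], ∀ v, c i * v = v → c i * aeval (mulL y) p v = aeval (mulL y) p v := by
    intro p
    induction p using Polynomial.induction_on with
    | C a => intro v hv; simp [Module.algebraMap_end_apply, mul_smul_comm, hv]
    | add p q hp hq => intro v hv; rw [map_add, LinearMap.add_apply, mul_add, hp v hv, hq v hv]
    | monomial n a hp =>
      intro v hv
      rw [pow_succ, ← mul_assoc, map_mul, aeval_X, Module.End.mul_apply]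
      exact hp _ (hinv v hv)
  set p := minPoly y
  have hp0 : ∑ j ∈ s.erase i, p.eval j • c j + aeval (mulL y) p (c i) = 0 := by
    rw [← evalAt_minPoly y, evalAt, ← h.sum_eq, ← Finset.sum_erase_add _ _ hi, map_add, map_sum]
    congr 1
    exact Finset.sum_congr rfl fun j hj => (IsFrame.aeval_mulL_apply_of_mul_eq (hyj j hj) p).symm
  have hpci : aeval (mulL y) p (c i) = 0 := by
    have h1 := hinv' p (c i) hci
    have h2 := congrArg (c i * ·) hp0
    simp only [mul_add, Finset.mul_sum, mul_zero, h1] at h2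
    rwa [Finset.sum_eq_zero, zero_add] at h2
    intro j hj
    have hj' := Finset.mem_erase.1 hj
    rw [mul_smul_comm, h.mul_ne i hi j hj'.2 hj'.1.symm, smul_zero]
  have hroot : ∀ j ∈ s.erase i, p.eval j = 0 := by
    rw [hpci, add_zero] at hp0
    intro j hj
    have hj' := Finset.mem_erase.1 hj
    have := h.eq_zero_of_sum_eq_zero (m := fun j => if j = i then 0 else p.eval j) (by
      rw [← Finset.sum_erase_add _ _ hi, if_pos rfl, zero_smul, add_zero, ← hp0]
      exact Finset.sum_congr rfl fun k hk => by rw [if_neg (Finset.mem_erase.1 hk).1]) j hj'.2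
    rwa [if_neg hj'.1] at this
  obtain ⟨q, hq⟩ : ∏ a ∈ s.erase i, (X - C a) ∣ p := by
    refine Finset.prod_dvd_of_coprime ?_ fun a ha => dvd_iff_isRoot.2 (hroot a ha)
    intro a _ b _ hab
    exact Polynomial.isCoprime_X_sub_C_of_isUnit_sub (sub_ne_zero.2 hab).isUnit
  have hmon : (∏ a ∈ s.erase i, (X - C a)).Monic :=
    monic_prod_of_monic _ _ fun a _ => monic_X_sub_C a
  have hqm : q.Monic := hmon.of_mul_monic_left (hq ▸ minPoly_monic y)
  have hqd : q.natDegree ≤ 1 := by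
    have h1 := natDegree_minPoly_le_rank y
    rw [show minPoly y = p from rfl, hq, hmon.natDegree_mul hqm,
      natDegree_prod_of_monic _ _ fun a _ => monic_X_sub_C a] at h1
    simp [Finset.card_erase_of_mem hi, hs] at h1
    have : 0 < rank V := hs ▸ Finset.card_pos.2 ⟨i, hi⟩
    omega
  -- By the choice of t, each factor L(y) - a is injective on the 1-space of c_i, so the known
  -- factors can be cancelled.
  have hprod : ∀ T ⊆ s, ∀ v, c i * v = v → aeval (mulL y) (∏ a ∈ T, (X - C a)) v = 0 → v = 0 := by
    intro T
    induction T using Finset.induction_on with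
    | empty => intro _ v _ hv; simpa using hv
    | insert a T ha ih =>
      intro hT v hv h0
      rw [Finset.prod_insert ha, mul_comm, map_mul, Module.End.mul_apply] at h0
      have := ih ((Finset.subset_insert a T).trans hT) _ (hinv' _ v hv) h0
      refine hinj a (hT (Finset.mem_insert_self a T)) v ?_
      simp only [map_sub, aeval_X, aeval_C, LinearMap.sub_apply, Module.algebraMap_end_apply,
        mulL_apply, hyv v hv] at this
      linear_combination (norm := module) this
  have hq0 : aeval (mulL y) q (c i) = 0 := by
    refine hprod _ (Finset.erase_subset i s) _ (hinv' q _ hci) ?_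
    rw [← Module.End.mul_apply, ← map_mul, ← hq, hpci]
  rcases Nat.le_one_iff_eq_zero_or_eq_one.1 hqd with h0 | h1
  · rw [hqm.natDegree_eq_zero.1 h0] at hq0
    exact absurd (by simpa using hq0) (h.ne_zero i hi)
  · rw [hqm.eq_X_add_C h1] at hq0
    refine ⟨-q.coeff 0 - t, ?_⟩
    simp only [map_add, aeval_X, aeval_C, LinearMap.add_apply, Module.algebraMap_end_apply,
      mulL_apply, hyv _ hci, mul_comm z, hz] at hq0
    linear_combination (norm := module) hq0

theorem trace_mulL_eq_traceForm {c : V} (hc : c * c = c) :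
    LinearMap.trace ℝ V (mulL c) = traceForm V c c := by rw [traceForm_apply, hc]

/-- Two primitive orthogonal idempotents with a nonzero joint Peirce space have the same trace. -/
theorem trace_eq_of_half {c d x : V} (hc : c * c = c) (hd : d * d = d) (hcd : c * d = 0)
    (hc1 : ∀ z, c * z = z → ∃ a : ℝ, z = a • c) (hd1 : ∀ z, d * z = z → ∃ a : ℝ, z = a • d)
    (hcx : c * x = (1 / 2 : ℝ) • x) (hdx : d * x = (1 / 2 : ℝ) • x) (hx : x ≠ 0) :
    LinearMap.trace ℝ V (mulL c) = LinearMap.trace ℝ V (mulL d) := by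
  have hdc : d * c = 0 := by rw [mul_comm, hcd]
  have hE : (c + d) * (c + d) = c + d := by simp [mul_add, add_mul, hc, hd, hcd, hdc]
  have hEx : (c + d) * x = x := by
    rw [add_mul, hcx, hdx]; module
  have h1 := half_mul_half hc hcx
  obtain ⟨a, ha⟩ := hc1 _ h1
  have hdu : d * (c * (x * x)) = 0 := by rw [ha, mul_smul_comm, hdc, smul_zero]
  have hEx2 : (c + d) * (x * x) = x * x := one_mul_one hE hEx hEx
  obtain ⟨b, hb⟩ := hd1 (x * x - c * (x * x)) (by
    rw [mul_sub, hdu, sub_zero]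
    rw [add_mul] at hEx2
    exact eq_sub_of_add_eq' hEx2)
  have hxx : x * x = a • c + b • d := by rw [← ha, ← hb]; abel
  -- The Jordan identity (xc)x² = x(cx²) reads (a+b)/4 · x = a/2 · x.
  have hab : a = b := by
    have h2 := IsCommJordan.lmul_comm_rmul_rmul x c
    rw [mul_comm x c, hcx, hxx] at h2
    simp only [mul_add, mul_smul_comm, hc, hcd, smul_zero, add_zero, smul_mul_assoc, mul_comm x c,
      mul_comm x d, hcx, hdx] at h2
    have h3 : (b - a) • x = 0 := by linear_combination (norm := module) (4 : ℝ) • h2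
    exact (sub_eq_zero.1 ((smul_eq_zero.1 h3).resolve_right hx)).symm
  -- Both sides are β(x, x)/2; with x² = a(c + d) this becomes a β(c,c) = a β(d,d), and a = 0 would
  -- force x = 0.
  have h4 : traceForm V (x * x) c = traceForm V (x * x) d := by
    rw [traceForm_assoc, traceForm_assoc, mul_comm x c, mul_comm x d, hcx, hdx]
  have hcd' : traceForm V c d = 0 := by rw [traceForm_apply, hcd, mulL_zero, map_zero]
  rw [hxx, ← hab] at h4
  simp only [map_add, map_smul, LinearMap.add_apply, LinearMap.smul_apply, smul_eq_mul, hcd',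
    traceForm_comm d c, mul_zero, add_zero, zero_add] at h4
  rw [trace_mulL_eq_traceForm hc, trace_mulL_eq_traceForm hd]
  refine mul_left_cancel₀ (fun ha0 : a = 0 => hx (eq_zero_of_traceForm_self ?_)) h4
  have : traceForm V (x * x) (unit V) = 0 := by
    rw [hxx, ← hab, ha0]; simp
  rwa [traceForm_assoc, mul_unit] at this

/-- In a simple algebra, `0` and the identity are the only idempotents with vanishing half
Peirce space. -/
theorem eq_unit_of_mul_mul [IsSimpleRing V] {E : V} (hE : E * E = E) (hE0 : E ≠ 0)
    (h : ∀ x, E * (E * x) = E * x) : E = unit V := by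
  have key : ∀ x y : V, E * x = x → E * (x * y) = x * y := by
    intro x y hx
    have h0 : E * (y - E * y) = 0 := by rw [mul_sub, h, sub_self]
    have h1 : x * y = x * (E * y) := by
      rw [← sub_eq_zero, ← mul_sub, one_mul_zero hE hx h0]
    rw [h1, one_mul_one hE hx (h y)]
  -- Without a half space, the Peirce 1-space of E is an ideal.
  let I : TwoSidedIdeal V := TwoSidedIdeal.mk' {x | E * x = x} (mul_zero E)
    (fun {x y} hx hy => by
      change E * (x + y) = x + y
      rw [mul_add, hx, hy])
    (fun {x} hx => by
      change E * (-x) = -x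
      rw [mul_neg, hx])
    (fun {x y} hy => by
      change E * (x * y) = x * y
      rw [mul_comm x y, key y x hy])
    (fun {x y} hx => key x y hx)
  have hI : ∀ x, x ∈ I ↔ E * x = x := fun x => TwoSidedIdeal.mem_mk' _ _ _ _ _ _ x
  rcases eq_bot_or_eq_top I with hb | ht
  · have : E ∈ I := (hI E).2 hE
    rw [hb, TwoSidedIdeal.mem_bot] at this
    exact absurd this hE0
  · have : unit V ∈ I := by rw [ht]; trivial
    rw [hI, mul_unit] at this
    exact this

/-- In a simple algebra the idempotents of the frame of a regular element have the same trace. -/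
theorem IsFrame.trace_eq [IsSimpleRing V] {s : Finset ℝ} {c : ℝ → V} (h : IsFrame s c)
    (hs : s.card = rank V) {i j : ℝ} (hi : i ∈ s) (hj : j ∈ s) :
    LinearMap.trace ℝ V (mulL (c i)) = LinearMap.trace ℝ V (mulL (c j)) := by
  classical
  by_contra hij
  let τ : ℝ → ℝ := fun k => LinearMap.trace ℝ V (mulL (c k))
  let S := s.filter fun k => τ k = τ i
  have hS : ∀ k ∈ S, k ∈ s := fun k hk => (Finset.mem_filter.1 hk).1
  have hiS : i ∈ S := Finset.mem_filter.2 ⟨hi, rfl⟩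
  have hjS : j ∉ S := fun hj' => hij (Finset.mem_filter.1 hj').2.symm
  let E := ∑ k ∈ S, c k
  have hEk : ∀ k ∈ S, E * c k = c k := by
    intro k hk
    rw [Finset.sum_mul, Finset.sum_eq_single_of_mem k hk, h.mul_self k (hS k hk)]
    exact fun l hl hlk => h.mul_ne l (hS l hl) k (hS k hk) hlk
  have hEk' : ∀ k ∈ s, k ∉ S → E * c k = 0 := by
    intro k hk hk'
    rw [Finset.sum_mul]
    exact Finset.sum_eq_zero fun l hl => h.mul_ne l (hS l hl) k hk fun e => hk' (e ▸ hl)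
  have hEE : E * E = E := by
    change E * ∑ k ∈ S, c k = ∑ k ∈ S, c k
    rw [Finset.mul_sum]
    exact Finset.sum_congr rfl hEk
  have hE0 : E ≠ 0 := by
    intro h0
    have := hEk i hiS
    rw [h0, zero_mul] at this
    exact h.ne_zero i hi this.symm
  -- A nonzero value would lie in the half spaces of both idempotents and force equal traces. Hence
  -- E has no half space, so E = e, although E annihilates c_j.
  have hzero : ∀ k ∈ S, ∀ l ∈ s, l ∉ S → ∀ x, c k * (c l * x) = 0 := by
    intro k hk l hl hlS x
    by_contra hx
    have hkl : k ≠ l := fun e => hlS (e ▸ hk)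
    have hcd := h.mul_ne k (hS k hk) l hl hkl
    have hk1 := h.mul_self k (hS k hk)
    have hl1 := h.mul_self l hl
    have := trace_eq_of_half hk1 hl1 hcd (fun z => h.exists_eq_smul hs (hS k hk))
      (fun z => h.exists_eq_smul hs hl) (orthogonal_mul_half hk1 hcd x)
      (by rw [orthogonal_commute hk1 hcd, orthogonal_mul_half hl1 (by rw [mul_comm, hcd])]) hx
    exact hlS (Finset.mem_filter.2 ⟨hl, by rw [← (Finset.mem_filter.1 hk).2]; exact this.symm⟩)
  have hcompl : unit V - E = ∑ l ∈ s.filter (fun l => l ∉ S), c l := by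
    rw [← h.sum_eq, ← Finset.sum_filter_add_sum_filter_not s (fun l => l ∈ S),
      Finset.filter_mem_eq_inter, Finset.inter_eq_right.2 hS, add_sub_cancel_left]
  have hEx : ∀ x, E * (E * x) = E * x := by
    intro x
    have h0 : E * ((unit V - E) * x) = 0 := by
      rw [hcompl, Finset.sum_mul, Finset.sum_mul]
      refine Finset.sum_eq_zero fun k hk => ?_
      rw [Finset.mul_sum]
      refine Finset.sum_eq_zero fun l hl => ?_
      exact hzero k hk l (Finset.mem_filter.1 hl).1 (Finset.mem_filter.1 hl).2 x
    rw [sub_mul, unit_mul, mul_sub, sub_eq_zero] at h0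
    exact h0.symm
  have := hEk' j hj hjS
  rw [eq_unit_of_mul_mul hEE hE0 hEx, unit_mul] at this
  exact h.ne_zero j hj this

theorem IsFrame.rank_mul_trace [IsSimpleRing V] {s : Finset ℝ} {c : ℝ → V} (h : IsFrame s c)
    (hs : s.card = rank V) {i : ℝ} (hi : i ∈ s) :
    (rank V : ℝ) * LinearMap.trace ℝ V (mulL (c i)) = Module.finrank ℝ V := by
  rw [← LinearMap.trace_one ℝ V, ← mulL_unit, ← h.sum_eq, mulL_sum, map_sum,
    Finset.sum_congr rfl fun j hj => h.trace_eq hs hj hi]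
  simp [hs]

/-! ### Exponentials of multiplication operators for a bilinear map -/

section Bilinear

variable {E : Type*} [NormedAddCommGroup E] [InnerProductSpace ℝ E] [FiniteDimensional ℝ E]

/-- A bilinear map on a finite-dimensional space as a continuous bilinear map. -/
def toCLM₂ (B : E →ₗ[ℝ] E →ₗ[ℝ] E) : E →L[ℝ] E →L[ℝ] E :=
  LinearMap.toContinuousLinearMap
    ((LinearMap.toContinuousLinearMap : (E →ₗ[ℝ] E) ≃ₗ[ℝ] (E →L[ℝ] E)).toLinearMap ∘ₗ B)

variable (L : E →L[ℝ] E →L[ℝ] E)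

/-- The operator `2 L(x) ^ 2 - L(x ^ 2)`. -/
def bilinQuad (x : E) : E →L[ℝ] E := (2 : ℝ) • (L x * L x) - L (L x x)

theorem continuous_bilinQuad : Continuous (bilinQuad L) := by
  have h1 : Continuous fun x => L x := L.continuous
  exact ((h1.mul h1).const_smul (2 : ℝ)).sub (L.continuous.comp (h1.clm_apply continuous_id))

/-- The flow `exp L(h)`. -/
def bilinFlow (h : E) : E →L[ℝ] E := NormedSpace.exp (L h)

theorem hasDerivAt_bilinFlow (h : E) (t : ℝ) :
    HasDerivAt (fun t : ℝ => bilinFlow L (t • h)) (bilinFlow L (t • h) * L h) t := by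
  simp only [bilinFlow, map_smul]
  exact hasDerivAt_exp_smul_const (L h) t

theorem hasDerivAt_bilinFlow' (h : E) (t : ℝ) :
    HasDerivAt (fun t : ℝ => bilinFlow L (t • h)) (L h * bilinFlow L (t • h)) t := by
  simp only [bilinFlow, map_smul]
  exact hasDerivAt_exp_smul_const' (L h) t

theorem continuous_bilinFlow_smul (h w : E) : Continuous fun t : ℝ => bilinFlow L (t • h) w :=
  continuous_iff_continuousAt.2 fun t =>
    ((hasDerivAt_bilinFlow L h t).clm_apply (hasDerivAt_const t w)).continuousAt

theorem bilinFlow_neg_mul (h : E) : bilinFlow L (-h) * bilinFlow L h = 1 := by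
  let : NormedAlgebra ℚ (E →L[ℝ] E) := NormedAlgebra.restrictScalars ℚ ℝ _
  rw [bilinFlow, bilinFlow, ← NormedSpace.exp_add_of_commute]
  · simp
  · rw [map_neg]; exact (Commute.refl _).neg_left

theorem bilinFlow_mul_neg (h : E) : bilinFlow L h * bilinFlow L (-h) = 1 := by
  simpa using bilinFlow_neg_mul L (-h)

theorem bilinFlow_zero : bilinFlow L 0 = 1 := by simp [bilinFlow]

/-- `hL` is the infinitesimal form: the derivative of P at w along hw is L(h)P(w) + P(w)L(h). Hence
exp(-tL(h)) P(exp(tL(h))w) exp(-tL(h)) is constant in t. -/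
theorem bilinQuad_bilinFlow (hcomm : ∀ x y, L x y = L y x)
    (hL : ∀ h w, (2 : ℝ) • (L (L h w) * L w + L w * L (L h w)) - (2 : ℝ) • L (L (L h w) w)
      = L h * bilinQuad L w + bilinQuad L w * L h) (h w : E) :
    bilinQuad L (bilinFlow L h w) = bilinFlow L h * bilinQuad L w * bilinFlow L h := by
  let A : ℝ → E →L[ℝ] E := fun t =>
    bilinFlow L (t • -h) * bilinQuad L (bilinFlow L (t • h) w) * bilinFlow L (t • -h)
  have hA : ∀ t, HasDerivAt A 0 t := by
    intro t
    have hγ : HasDerivAt (fun t : ℝ => bilinFlow L (t • h) w) (L h (bilinFlow L (t • h) w)) t := by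
      simpa using (hasDerivAt_bilinFlow' L h t).clm_apply (hasDerivAt_const t w)
    set u := bilinFlow L (t • h) w with hu
    have h1 : HasDerivAt (fun t : ℝ => L (bilinFlow L (t • h) w)) (L (L h u)) t :=
      L.hasFDerivAt.comp_hasDerivAt t hγ
    have hQ : HasDerivAt (fun t : ℝ => bilinQuad L (bilinFlow L (t • h) w))
        (L h * bilinQuad L u + bilinQuad L u * L h) t := by
      have := ((h1.mul h1).const_smul (2 : ℝ)).sub
        (L.hasFDerivAt.comp_hasDerivAt t (h1.clm_apply hγ))
      refine this.congr_deriv ?_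
      rw [← hL]
      simp only [← hu, map_add]
      rw [hcomm u (L h u), ← two_smul ℝ (L (L (L h u) u))]
    have := ((hasDerivAt_bilinFlow L (-h) t).mul hQ).mul (hasDerivAt_bilinFlow' L (-h) t)
    refine this.congr_deriv ?_
    rw [Pi.mul_apply, map_neg, ← hu]
    noncomm_ring
  have hc := is_const_of_deriv_eq_zero (fun t => (hA t).differentiableAt)
    (fun t => (hA t).deriv) 1 0
  simp only [A, one_smul, zero_smul, bilinFlow_zero, one_mul, mul_one,
    one_apply_eq_self] at hc
  rw [← hc, mul_assoc, mul_assoc, bilinFlow_neg_mul, mul_one, ← mul_assoc, bilinFlow_mul_neg,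
    one_mul]

theorem bilinFlow_apply_of_eq {h v : E} {a : ℝ} (hv : L h v = a • v) :
    bilinFlow L h v = Real.exp a • v := by
  let : NormedAlgebra ℚ (E →L[ℝ] E) := NormedAlgebra.restrictScalars ℚ ℝ _
  have hp : ∀ n : ℕ, (L h ^ n) v = a ^ n • v := by
    intro n
    induction n with
    | zero => simp
    | succ n ih =>
      rw [pow_succ', mul_apply_eq_comp, ih, map_smul, hv, smul_smul, pow_succ]
  have h1 := (NormedSpace.exp_series_hasSum_exp' (𝕂 := ℝ) (L h)).mapL
    (ContinuousLinearMap.apply ℝ E v)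
  have h2 := (NormedSpace.exp_series_hasSum_exp' (𝕂 := ℝ) a).smul_const v
  rw [Real.exp_eq_exp_ℝ]
  refine h1.unique ?_
  convert h2 using 2 with n
  simp [hp, smul_smul]

theorem det_bilinFlow {h : E} (hs : (L h : E →ₗ[ℝ] E).IsSymmetric) :
    (bilinFlow L h).det = Real.exp (LinearMap.trace ℝ E (L h)) := by
  let b := (hs.eigenvectorBasis rfl).toBasis
  let m := hs.eigenvalues rfl
  have hb : ∀ i, L h (b i) = m i • b i := fun i => by
    simp only [b, OrthonormalBasis.coe_toBasis]
    exact hs.apply_eigenvectorBasis rfl i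
  have e1 : LinearMap.toMatrix b b (bilinFlow L h : E →ₗ[ℝ] E)
      = Matrix.diagonal fun i => Real.exp (m i) := by
    ext i j
    rw [LinearMap.toMatrix_apply, ContinuousLinearMap.coe_coe, bilinFlow_apply_of_eq L (hb j)]
    simp [Matrix.diagonal_apply, Finsupp.single_apply, eq_comm]
    grind
  have e2 : LinearMap.toMatrix b b (L h : E →ₗ[ℝ] E) = Matrix.diagonal m := by
    ext i j
    rw [LinearMap.toMatrix_apply, ContinuousLinearMap.coe_coe, hb j]
    simp [Matrix.diagonal_apply, Finsupp.single_apply, eq_comm]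
    grind
  rw [ContinuousLinearMap.det, ← LinearMap.det_toMatrix b, e1, Matrix.det_diagonal,
    LinearMap.trace_eq_matrix_trace ℝ b, e2, Matrix.trace_diagonal, Real.exp_sum]

end Bilinear

/-! ### The quadratic representation and the flow of a multiplication operator -/

variable (V) in
/-- Multiplication as a continuous bilinear map. -/
def opL := toCLM₂ (E := V) (LinearMap.mul ℝ V)

theorem continuous_mul_mul : Continuous fun p : V × V => p.1 * p.2 :=
  (opL V).continuous₂

theorem exists_norm_mul_le : ∃ C > 0, ∀ x y : V, ‖x * y‖ ≤ C * ‖x‖ * ‖y‖ :=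
  ⟨‖opL V‖ + 1, by positivity, fun x y => ((opL V).le_opNorm₂ x y).trans (by gcongr; linarith)⟩

/-- The determinant of the quadratic representation `P(x) = 2 L(x) ^ 2 - L(x ^ 2)`. -/
def quadDet (x : V) : ℝ := (bilinQuad (opL V) x).det

theorem continuous_quadDet : Continuous (quadDet : V → ℝ) :=
  ContinuousLinearMap.continuous_det.comp (continuous_bilinQuad (opL V))

/-- The flow `exp L(h)`. -/
def flow (h : V) : V →ₗ[ℝ] V := (bilinFlow (opL V) h).toLinearMap

theorem continuous_flow_smul (h w : V) : Continuous fun t : ℝ => flow (t • h) w :=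
  continuous_bilinFlow_smul (opL V) h w

theorem flow_zero_apply (w : V) : flow 0 w = w := by
  change bilinFlow (opL V) 0 w = w
  rw [bilinFlow_zero]; rfl

theorem flow_apply_of_mul_eq {h v : V} {a : ℝ} (hv : h * v = a • v) :
    flow h v = Real.exp a • v :=
  bilinFlow_apply_of_eq (opL V) hv

theorem det_flow (h : V) : (flow h).det = Real.exp (LinearMap.trace ℝ V (mulL h)) :=
  det_bilinFlow (opL V) (isSymmetric_mulL h)

theorem det_flow_pos (h : V) : 0 < (flow h).det := det_flow h ▸ Real.exp_pos _

/-- The infinitesimal identity is a combination of two instances of the linearized Jordan identity.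
-/
theorem bilinQuad_flow (h w : V) : bilinQuad (opL V) (flow h w)
    = bilinFlow (opL V) h * bilinQuad (opL V) w * bilinFlow (opL V) h := by
  refine bilinQuad_bilinFlow (opL V) (fun x y => mul_comm x y) (fun h w => ?_) h w
  ext v
  change (2 : ℝ) • (h * w * (w * v) + w * (h * w * v)) - (2 : ℝ) • (h * w * w * v)
    = h * ((2 : ℝ) • (w * (w * v)) - w * w * v)
      + ((2 : ℝ) • (w * (w * (h * v))) - w * w * (h * v))
  rw [mul_sub, mul_smul_comm]
  have h1 := jordan_linearized h w w v
  have h2 := jordan_linearized w w v h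
  rw [mul_comm v (w * h), mul_comm (w * w * v) h, mul_comm w h, mul_comm (w * v) (h * w),
    mul_comm v h] at h2
  linear_combination (norm := module) (-2 : ℝ) • h1 + h2

theorem quadDet_flow (h w : V) : quadDet (flow h w) = (flow h).det ^ 2 * quadDet w := by
  have e : ∀ A B : V →ₗ[ℝ] V, (A * B).det = A.det * B.det := fun A B => LinearMap.det_comp A B
  have h1 : quadDet (flow h w)
      = (flow h * (bilinQuad (opL V) w).toLinearMap * flow h : V →ₗ[ℝ] V).det := by
    rw [quadDet, bilinQuad_flow]; rfl
  rw [h1, e, e, quadDet, ContinuousLinearMap.det]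
  ring

theorem quadDet_unit : quadDet (unit V) = 1 := by
  have : (bilinQuad (opL V) (unit V)).toLinearMap = LinearMap.id := by
    ext v
    change (2 : ℝ) • (unit V * (unit V * v)) - unit V * unit V * v = v
    rw [unit_mul, unit_mul, unit_mul, unit_mul]
    module
  rw [quadDet, ContinuousLinearMap.det, this]
  exact LinearMap.det_id

theorem quadDet_flow_unit (h : V) : quadDet (flow h (unit V)) = (flow h).det ^ 2 := by
  rw [quadDet_flow, quadDet_unit, mul_one]

theorem IsFrame.flow_unit {ι : Type*} {s : Finset ι} {c : ι → V} (h : IsFrame s c) {m : ι → ℝ}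
    (hm : ∀ i ∈ s, 0 < m i) :
    flow (∑ i ∈ s, Real.log (m i) • c i) (unit V) = ∑ i ∈ s, m i • c i := by
  conv_lhs => rw [← h.sum_eq]
  rw [map_sum]
  refine Finset.sum_congr rfl fun i hi => ?_
  rw [flow_apply_of_mul_eq (h.sum_smul_mul _ hi), Real.exp_log (hm i hi)]

/-- Homogeneity of the cone, with h = log y taken in the frame of y. -/
theorem exists_flow_unit_eq {y : V} (hy : y ∈ cone V) : ∃ h : V, flow h (unit V) = y := by
  obtain ⟨s, c, h, rfl⟩ := exists_isFrame y
  exact ⟨_, h.flow_unit (m := id) (h.coeff_pos (mem_cone_iff.1 hy))⟩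

theorem quadDet_pos {y : V} (hy : y ∈ cone V) : 0 < quadDet y := by
  obtain ⟨h, rfl⟩ := exists_flow_unit_eq hy
  rw [quadDet_flow_unit]
  exact pow_pos (det_flow_pos h) 2

/-! ### The cone is open and stable under the flow -/

/-- If ε lies below every spectral value of y, then L(y) - ε is positive definite, and a
perturbation of norm below ε/C changes L(y) by at most ε. -/
theorem isOpen_cone : IsOpen (cone V) := by
  rw [Metric.isOpen_iff]
  intro y hy
  obtain ⟨s, c, h, rfl⟩ := exists_isFrame y
  have hpos := h.coeff_pos (mem_cone_iff.1 hy)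
  obtain ⟨ε, hε, hεs⟩ : ∃ ε : ℝ, 0 < ε ∧ ∀ a ∈ s, ε < a := by
    rcases s.eq_empty_or_nonempty with rfl | hne
    · exact ⟨1, one_pos, by simp⟩
    · have := hpos _ (s.min'_mem hne)
      exact ⟨s.min' hne / 2, by positivity, fun a ha => by
        have := s.min'_le a ha
        linarith⟩
  obtain ⟨C, hC, hCle⟩ := exists_norm_mul_le (V := V)
  refine ⟨ε / C, by positivity, fun z hz => mem_cone_iff.2 fun v hv => ?_⟩
  set y := ∑ a ∈ s, a • c a
  have h1 : 0 < traceForm V ((y - ε • unit V) * v) v := by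
    rw [← h.sum_eq, Finset.smul_sum, ← Finset.sum_sub_distrib]
    simp only [← sub_smul]
    exact h.traceForm_mul_pos (fun a ha => sub_pos.2 (hεs a ha)) hv
  have h2 : |traceForm V ((z - y) * v) v| ≤ ε * traceForm V v v := by
    rw [mem_ball_iff_norm, lt_div_iff₀ (by positivity)] at hz
    have h3 : ‖(z - y) * v‖ ≤ ε * ‖v‖ := by
      refine (hCle _ _).trans (mul_le_mul_of_nonneg_right ?_ (norm_nonneg v))
      linarith
    rw [← inner_eq_traceForm, ← inner_eq_traceForm, real_inner_self_eq_norm_sq]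
    refine (abs_real_inner_le_norm _ _).trans ?_
    nlinarith [norm_nonneg v]
  have h4 := (abs_le.1 h2).1
  simp only [sub_mul, smul_mul_assoc, unit_mul, map_sub, map_smul, LinearMap.sub_apply,
    LinearMap.smul_apply, smul_eq_mul] at h1 h4
  linarith

/-- On the closure all spectral values are nonnegative, and an idempotent with value 0 lies in the
kernel of P(y). -/
theorem mem_cone_of_mem_closure {y : V} (hy : y ∈ closure (cone V)) (hd : quadDet y ≠ 0) :
    y ∈ cone V := by
  have hnn : ∀ v : V, 0 ≤ traceForm V (y * v) v := by
    intro v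
    have hcl : IsClosed {x : V | 0 ≤ inner ℝ (x * v) v} :=
      isClosed_le continuous_const ((continuous_mul_mul.comp
        (continuous_id.prodMk continuous_const)).inner continuous_const)
    refine closure_minimal (fun x hx => ?_) hcl hy
    rcases eq_or_ne v 0 with rfl | hv
    · simp
    · exact (mem_cone_iff.1 hx v hv).le
  obtain ⟨s, c, h, rfl⟩ := exists_isFrame y
  refine mem_cone_iff.2 fun v hv => h.traceForm_mul_pos (fun a ha => ?_) hv
  have hyc := h.sum_smul_mul (fun a => a) ha
  have h1 := hnn (c a)
  rw [hyc, map_smul, LinearMap.smul_apply, smul_eq_mul] at h1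
  refine lt_of_le_of_ne
    (nonneg_of_mul_nonneg_left h1 (EuclideanJordanAlgebra.traceForm_pos _ (h.ne_zero a ha))) ?_
  rintro rfl
  refine hd (LinearMap.det_eq_zero_iff_ker_ne_bot.2 ((Submodule.ne_bot_iff _).2
    ⟨c 0, ?_, h.ne_zero 0 ha⟩))
  rw [LinearMap.mem_ker]
  change (2 : ℝ) • ((∑ a ∈ s, a • c a) * ((∑ a ∈ s, a • c a) * c 0))
    - (∑ a ∈ s, a • c a) * (∑ a ∈ s, a • c a) * c 0 = 0
  rw [hyc, h.sum_mul_sum, h.sum_smul_mul (fun a => a * a) ha]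
  simp

/-- Along exp(tL(h))w, det P stays positive, so the curve cannot reach the boundary of the cone: the
times spent in the cone form a clopen set. -/
theorem flow_mem_cone (h : V) {w : V} (hw : w ∈ cone V) : flow h w ∈ cone V := by
  let γ : ℝ → V := fun t => flow (t • h) w
  have hγ : Continuous γ := continuous_flow_smul h w
  have hclopen : IsClopen (γ ⁻¹' cone V) := by
    refine ⟨isClosed_of_closure_subset fun t ht => ?_, isOpen_cone.preimage hγ⟩
    refine mem_cone_of_mem_closure (hγ.closure_preimage_subset _ ht) ?_
    rw [quadDet_flow]
    exact (mul_pos (pow_pos (det_flow_pos _) 2) (quadDet_pos hw)).ne'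
  have h0 : (0 : ℝ) ∈ γ ⁻¹' cone V := by simpa [γ, flow_zero_apply] using hw
  have h1 : (1 : ℝ) ∈ γ ⁻¹' cone V := by
    rw [hclopen.eq_univ ⟨0, h0⟩]; trivial
  simpa [γ] using h1

/-! ### Linear independence in analytic families -/

section Generic

variable {E : Type*} [NormedAddCommGroup E] [InnerProductSpace ℝ E]

open Filter Topology in
-- The Gram determinant is analytic in t and nonzero at t₁, so its zeros are isolated.
theorem eventually_linearIndependent {ι : Type*} [Fintype ι] {v : ι → ℝ → E}
    (hv : ∀ i t, AnalyticAt ℝ (v i) t) {t₁ : ℝ} (h₁ : LinearIndependent ℝ fun i => v i t₁) (t₀ : ℝ) :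
    ∀ᶠ t in 𝓝[≠] t₀, LinearIndependent ℝ fun i => v i t := by
  classical
  let G : ℝ → ℝ := fun t => (Matrix.gram ℝ fun i => v i t).det
  have hG : AnalyticOnNhd ℝ G Set.univ := by
    intro t _
    have he : ∀ i j, AnalyticAt ℝ (fun t => inner ℝ (v i t) (v j t)) t := fun i j =>
      ((innerSL ℝ (E := E)).analyticAt_bilinear (v i t, v j t)).comp₂ (hv i t) (hv j t)
    have : G = fun t => ∑ σ : Equiv.Perm ι,
        (Equiv.Perm.sign σ : ℝ) * ∏ i, inner ℝ (v (σ i) t) (v i t) := by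
      ext t
      simp [G, Matrix.det_apply', Matrix.gram_apply]
    rw [this]
    exact Finset.analyticAt_fun_sum _ fun σ _ =>
      analyticAt_const.mul (Finset.analyticAt_fun_prod _ fun i _ => he _ _)
  have hiff : ∀ t, G t ≠ 0 ↔ LinearIndependent ℝ fun i => v i t := fun t =>
    Matrix.det_gram_ne_zero_iff_linearIndependent
  rcases (hG t₀ trivial).eventually_eq_zero_or_eventually_ne_zero with h | h
  · exact absurd (hG.eqOn_zero_of_preconnected_of_eventuallyEq_zero isPreconnected_univ trivial h
      (Set.mem_univ t₁)) ((hiff t₁).2 h₁)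
  · exact h.mono fun t ht => (hiff t).1 ht

theorem analyticAt_bilin_pow (L : E →L[ℝ] E →L[ℝ] E) (x y e : E) (k : ℕ) (t : ℝ) :
    AnalyticAt ℝ (fun t : ℝ => ((L (x + t • y)) ^ k) e) t := by
  have h0 : AnalyticAt ℝ (fun t : ℝ => x + t • y) t :=
    analyticAt_const.add (analyticAt_id.smul analyticAt_const)
  have h1 : AnalyticAt ℝ (fun t : ℝ => L (x + t • y)) t := (L.analyticAt _).comp h0
  exact ((ContinuousLinearMap.apply ℝ E e).analyticAt _).comp (h1.pow k)

end Generic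

/-! ### Regular elements are dense -/

theorem evalAt_eq_zero_iff_dvd (x : V) (p : ℝ[X]) : evalAt x p = 0 ↔ minPoly x ∣ p := by
  rw [minPoly, normalize_dvd_iff, ← Submodule.IsPrincipal.mem_iff_generator_dvd]
  rfl

theorem isRegular_iff_linearIndependent (x : V) :
    IsRegular x ↔ LinearIndependent ℝ fun k : Fin (rank V) => (mulL x ^ (k : ℕ)) (unit V) := by
  have key : ∀ p : ℝ[X], p.natDegree < rank V →
      ∑ k : Fin (rank V), p.coeff k • (mulL x ^ (k : ℕ)) (unit V) = evalAt x p := by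
    intro p hp
    rw [Fin.sum_univ_eq_sum_range (fun k => p.coeff k • (mulL x ^ k) (unit V)), evalAt,
      aeval_eq_sum_range' hp]
    simp
  constructor
  · intro hx
    rw [Fintype.linearIndependent_iff]
    intro g hg
    let p : ℝ[X] := ∑ k : Fin (rank V), C (g k) * X ^ (k : ℕ)
    have hdeg : p.degree < rank V := by
      exact degree_sum_fin_lt g
    have hcoeff : ∀ k : Fin (rank V), p.coeff k = g k := by
      intro k
      simp [p, finsetSum_coeff, coeff_C_mul, coeff_X_pow, Fin.val_inj]
    have h0 : evalAt x p = 0 := by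
      rw [← hg]
      simp [evalAt, p, Module.algebraMap_end_apply]
    have hp : p = 0 := by
      by_contra hne
      have h1 := degree_le_of_dvd ((evalAt_eq_zero_iff_dvd x p).1 h0) hne
      rw [degree_eq_natDegree (minPoly_monic x).ne_zero, show (minPoly x).natDegree = rank V from hx]
        at h1
      exact absurd hdeg (not_lt.2 h1)
    intro k
    rw [← hcoeff, hp, coeff_zero]
  · intro hli
    refine le_antisymm (natDegree_minPoly_le_rank x) (not_lt.1 fun hlt => ?_)
    have h1 := key _ hlt
    rw [evalAt_minPoly] at h1
    have h2 := Fintype.linearIndependent_iff.1 hli _ h1 ⟨_, hlt⟩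
    rw [show (minPoly x).coeff ((⟨_, hlt⟩ : Fin (rank V)) : ℕ) = 1 from minPoly_monic x] at h2
    exact one_ne_zero h2

theorem mulL_pow_eq_opL_pow (x v : V) (k : ℕ) : (mulL x ^ k) v = (opL V x ^ k) v := by
  induction k with
  | zero => rfl
  | succ k ih =>
    rw [pow_succ', pow_succ', Module.End.mul_apply, ih]
    rfl

open Filter Topology in
-- On the line from x to a regular element, e, x, ..., x^(r-1) is an analytic family that is
-- independent at one point, hence at all nearby parameters t ≠ 0.
theorem dense_isRegular (x : V) : x ∈ closure {x : V | IsRegular x} := by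
  obtain ⟨x₁, hx₁⟩ := exists_isRegular V
  have h := eventually_linearIndependent (E := V) (ι := Fin (rank V)) (t₁ := 1)
    (v := fun k t => (opL V (x + t • (x₁ - x)) ^ (k : ℕ)) (unit V))
    (fun k t => analyticAt_bilin_pow (opL V) x (x₁ - x) (unit V) k t) (by
      rw [isRegular_iff_linearIndependent] at hx₁
      simpa [mulL_pow_eq_opL_pow] using hx₁) 0
  have hreg : ∀ᶠ t : ℝ in 𝓝[≠] 0, IsRegular (x + t • (x₁ - x)) := by
    refine h.mono fun t ht => ?_
    rw [isRegular_iff_linearIndependent]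
    simpa [mulL_pow_eq_opL_pow] using ht
  have ht : Tendsto (fun t : ℝ => x + t • (x₁ - x)) (𝓝[≠] 0) (𝓝 x) := by
    have : Continuous fun t : ℝ => x + t • (x₁ - x) :=
      continuous_const.add (continuous_id.smul (M := ℝ) (X := V) continuous_const)
    have h2 := this.tendsto 0
    rw [zero_smul, add_zero] at h2
    exact h2.mono_left nhdsWithin_le_nhds
  exact mem_closure_of_tendsto ht hreg

/-! ### The Jordan determinant on the cone -/

theorem unit_ne_zero [Nontrivial V] : unit V ≠ 0 := by
  intro h
  obtain ⟨x, hx⟩ := exists_ne (0 : V)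
  exact hx (by rw [← unit_mul x, h, zero_mul])

theorem rank_pos [Nontrivial V] : 0 < rank V := by
  obtain ⟨x, hx⟩ := exists_isRegular V
  obtain ⟨s, c, h, rfl⟩ := exists_isFrame x
  rw [← show _ = rank V from hx, h.natDegree_minPoly, Finset.card_pos, Finset.nonempty_iff_ne_empty]
  rintro rfl
  exact unit_ne_zero (by simpa using h.sum_eq.symm)

theorem nontrivial_of_isSimpleRing [IsSimpleRing V] : Nontrivial V := by
  by_contra hV
  rw [not_nontrivial_iff_subsingleton] at hV
  exact bot_ne_top (α := TwoSidedIdeal V) (TwoSidedIdeal.ext fun x => by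
    rw [Subsingleton.elim x 0]
    exact iff_of_true (TwoSidedIdeal.zero_mem _) (TwoSidedIdeal.zero_mem _))

/-- The left side is the product of the spectral values a. Since y = exp L(h) e with h = Σ log(a)
c_a, det P(y) = exp(2 tr L(h)), and tr L(c_a) = n/r turns this into the product to the power 2n/r.
-/
theorem coeff_zero_minPoly_eq [IsSimpleRing V] {y : V} (hy : y ∈ cone V) (hreg : IsRegular y) :
    (-1) ^ rank V * (minPoly y).coeff 0
      = quadDet y ^ ((rank V : ℝ) / (2 * (Module.finrank ℝ V : ℝ))) := by
  have := nontrivial_of_isSimpleRing (V := V)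
  have hr : (rank V : ℝ) ≠ 0 := Nat.cast_ne_zero.2 rank_pos.ne'
  have hn : (Module.finrank ℝ V : ℝ) ≠ 0 := Nat.cast_ne_zero.2 Module.finrank_pos.ne'
  obtain ⟨s, c, h, rfl⟩ := exists_isFrame y
  have hpos := h.coeff_pos (mem_cone_iff.1 hy)
  have hs : s.card = rank V := h.natDegree_minPoly.symm.trans hreg
  have h1 : (-1) ^ rank V * (minPoly (∑ a ∈ s, a • c a)).coeff 0 = ∏ a ∈ s, a := by
    rw [h.minPoly_eq, coeff_zero_eq_eval_zero, eval_prod, ← hs, ← Finset.prod_const,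
      ← Finset.prod_mul_distrib]
    simp
  have h2 : ∀ a ∈ s, LinearMap.trace ℝ V (mulL (c a))
      = (Module.finrank ℝ V : ℝ) / (rank V : ℝ) := by
    intro a ha
    rw [eq_div_iff hr, mul_comm]
    exact h.rank_mul_trace hs ha
  have h3 : ∏ a ∈ s, a = Real.exp (∑ a ∈ s, Real.log a) := by
    rw [Real.exp_sum]
    exact Finset.prod_congr rfl fun a ha => (Real.exp_log (hpos a ha)).symm
  rw [h1, h3, ← h.flow_unit (m := fun a => a) hpos, quadDet_flow_unit, det_flow, ← Real.exp_nat_mul,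
    ← Real.exp_mul, mulL_sum, map_sum]
  congr 1
  have h4 : ∑ a ∈ s, LinearMap.trace ℝ V (mulL (Real.log a • c a))
      = (∑ a ∈ s, Real.log a) * ((Module.finrank ℝ V : ℝ) / (rank V : ℝ)) := by
    rw [Finset.sum_mul]
    refine Finset.sum_congr rfl fun a ha => ?_
    rw [mulL_smul, map_smul, h2 a ha, smul_eq_mul]
  rw [h4]
  push_cast
  field_simp

open Filter Topology in
theorem jdet_eq [IsSimpleRing V] {y : V} (hy : y ∈ cone V) :
    jdet y = quadDet y ^ ((rank V : ℝ) / (2 * (Module.finrank ℝ V : ℝ))) := by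
  refine extendFrom_eq (dense_isRegular y) ?_
  have h1 : Tendsto (fun x : V => quadDet x ^ ((rank V : ℝ) / (2 * (Module.finrank ℝ V : ℝ))))
      (𝓝 y) (𝓝 (quadDet y ^ ((rank V : ℝ) / (2 * (Module.finrank ℝ V : ℝ))))) :=
    continuous_quadDet.continuousAt.tendsto.rpow_const (Or.inl (quadDet_pos hy).ne')
  refine (h1.mono_left nhdsWithin_le_nhds).congr' ?_
  filter_upwards [self_mem_nhdsWithin, mem_nhdsWithin_of_mem_nhds (isOpen_cone.mem_nhds hy)]
    with x hx hxc
  exact (coeff_zero_minPoly_eq hxc hx).symm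

/-! ### Holomorphic functions on a complexification -/

section Complexification

variable {E : Type*} [NormedAddCommGroup E] [InnerProductSpace ℝ E]

/-- Makes the tensor product norm a complex norm, so that the calculus of holomorphic functions
applies on the complexification. -/
theorem inner_complex_smul (a : ℂ) (z w : ℂ ⊗[ℝ] E) :
    inner ℝ (a • z) (a • w) = ‖a‖ ^ 2 * inner ℝ z w := by
  induction z using TensorProduct.induction_on with
  | zero => simp
  | add z₁ z₂ h₁ h₂ => rw [smul_add, inner_add_left, inner_add_left, h₁, h₂, mul_add]
  | tmul c x =>
    induction w using TensorProduct.induction_on with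
    | zero => simp
    | add w₁ w₂ h₁ h₂ => rw [smul_add, inner_add_right, inner_add_right, h₁, h₂, mul_add]
    | tmul d y =>
      rw [TensorProduct.smul_tmul', TensorProduct.smul_tmul', TensorProduct.inner_tmul,
        TensorProduct.inner_tmul, ← mul_assoc]
      congr 1
      simp only [smul_eq_mul, Complex.inner, map_mul]
      rw [← Complex.normSq_eq_norm_sq, Complex.normSq_apply]
      simp
      ring

theorem norm_complex_smul (a : ℂ) (z : ℂ ⊗[ℝ] E) : ‖a • z‖ = ‖a‖ * ‖z‖ := by
  rw [← sq_eq_sq₀ (norm_nonneg _) (by positivity), mul_pow, ← real_inner_self_eq_norm_sq (a • z),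
    ← real_inner_self_eq_norm_sq z, inner_complex_smul]

/-- The complexification of a Euclidean space is a complex normed space. -/
@[reducible] def complexificationNormedSpace : NormedSpace ℂ (ℂ ⊗[ℝ] E) where
  norm_smul_le a z := (norm_complex_smul a z).le

theorem differentiableOn_mul_complexification {F₁ F₂ : ℂ ⊗[ℝ] E → ℂ} {S : Set (ℂ ⊗[ℝ] E)}
    (h₁ : DifferentiableOn ℂ F₁ S) (h₂ : DifferentiableOn ℂ F₂ S) :
    DifferentiableOn ℂ (fun z => F₁ z * F₂ z) S := by
  let : NormedSpace ℂ (ℂ ⊗[ℝ] E) := complexificationNormedSpace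
  exact DifferentiableOn.mul h₁ h₂

theorem continuousOn_of_differentiableOn_complexification {F : ℂ ⊗[ℝ] E → ℂ}
    {S : Set (ℂ ⊗[ℝ] E)} (h : DifferentiableOn ℂ F S) : ContinuousOn F S := by
  let : NormedSpace ℂ (ℂ ⊗[ℝ] E) := complexificationNormedSpace
  exact h.continuousOn

theorem diffContOnCl_line {F : ℂ ⊗[ℝ] E → ℂ} {S : Set (ℂ ⊗[ℝ] E)} (h : DifferentiableOn ℂ F S)
    {z w : ℂ ⊗[ℝ] E} (hS : ∀ a ∈ Metric.closedBall (0 : ℂ) 1, z + a • w ∈ S) :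
    DiffContOnCl ℂ (fun a : ℂ => F (z + a • w)) (Metric.ball 0 1) := by
  let : NormedSpace ℂ (ℂ ⊗[ℝ] E) := complexificationNormedSpace
  apply DifferentiableOn.diffContOnCl
  rw [closure_ball _ one_ne_zero]
  have h1 : DifferentiableOn ℂ (fun a : ℂ => z + a • w) (Metric.closedBall 0 1) := by fun_prop
  exact h.comp h1 hS

/-- The point `x + i y` of the complexification. -/
def toComplexification (p : E × E) : ℂ ⊗[ℝ] E := 1 ⊗ₜ[ℝ] p.1 + Complex.I ⊗ₜ[ℝ] p.2

theorem continuous_toComplexification [FiniteDimensional ℝ E] :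
    Continuous (toComplexification (E := E)) := by
  let f : E × E →ₗ[ℝ] ℂ ⊗[ℝ] E :=
    (TensorProduct.mk ℝ ℂ E 1).comp (LinearMap.fst ℝ E E)
      + (TensorProduct.mk ℝ ℂ E Complex.I).comp (LinearMap.snd ℝ E E)
  exact f.continuous_of_finiteDimensional

theorem toComplexification_add (p q : E × E) :
    toComplexification (p + q) = toComplexification p + toComplexification q := by
  simp only [toComplexification, Prod.fst_add, Prod.snd_add, TensorProduct.tmul_add]
  abel

/-- Complex scalar multiplication on `E × E`, identified with the complexification of `E`. -/
def complexScale (a : ℂ) : E × E →ₗ[ℝ] E × E :=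
  (a.re • LinearMap.fst ℝ E E - a.im • LinearMap.snd ℝ E E).prod
    (a.im • LinearMap.fst ℝ E E + a.re • LinearMap.snd ℝ E E)

theorem complexScale_apply (a : ℂ) (p : E × E) :
    complexScale a p = (a.re • p.1 - a.im • p.2, a.im • p.1 + a.re • p.2) := rfl

theorem toComplexification_complexScale (a : ℂ) (p : E × E) :
    toComplexification (complexScale a p) = a • toComplexification p := by
  have h1 : a • (1 ⊗ₜ[ℝ] p.1 : ℂ ⊗[ℝ] E) = a.re • (1 ⊗ₜ[ℝ] p.1) + a.im • (Complex.I ⊗ₜ[ℝ] p.1) := by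
    rw [TensorProduct.smul_tmul', TensorProduct.smul_tmul', TensorProduct.smul_tmul',
      ← TensorProduct.add_tmul]
    congr 1
    apply Complex.ext <;> simp
  have h2 : a • (Complex.I ⊗ₜ[ℝ] p.2 : ℂ ⊗[ℝ] E)
      = a.re • (Complex.I ⊗ₜ[ℝ] p.2) - a.im • (1 ⊗ₜ[ℝ] p.2) := by
    rw [TensorProduct.smul_tmul', TensorProduct.smul_tmul', TensorProduct.smul_tmul',
      ← TensorProduct.sub_tmul]
    congr 1
    apply Complex.ext <;> simp
  unfold toComplexification
  rw [smul_add, h1, h2, complexScale_apply]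
  simp only [TensorProduct.tmul_add, TensorProduct.tmul_sub, TensorProduct.tmul_smul]
  abel

end Complexification

/-! ### The mean value inequality -/

section MeanValue

variable {E : Type*} [NormedAddCommGroup E] [InnerProductSpace ℝ E] [FiniteDimensional ℝ E]
  [MeasurableSpace E] [BorelSpace E]

variable (E) in
/-- The Euclidean ball in `E × E`. -/
def euclBall (ρ : ℝ) : Set (E × E) := {p | ‖p.1‖ ^ 2 + ‖p.2‖ ^ 2 < ρ ^ 2}

theorem isOpen_euclBall (ρ : ℝ) : IsOpen (euclBall E ρ) :=
  isOpen_lt (by fun_prop) continuous_const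

theorem zero_mem_euclBall {ρ : ℝ} (hρ : 0 < ρ) : (0 : E × E) ∈ euclBall E ρ := by
  simp only [euclBall, Set.mem_ofPred_eq, Prod.fst_zero, Prod.snd_zero, norm_zero]
  have := pow_pos hρ 2
  simpa using this

theorem norm_lt_of_mem_euclBall {ρ : ℝ} (hρ : 0 < ρ) {p : E × E} (hp : p ∈ euclBall E ρ) :
    ‖p.1‖ < ρ ∧ ‖p.2‖ < ρ := by
  have hp' : ‖p.1‖ ^ 2 + ‖p.2‖ ^ 2 < ρ ^ 2 := hp
  constructor <;> refine lt_of_pow_lt_pow_left₀ 2 hρ.le ?_ <;>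
    nlinarith [sq_nonneg ‖p.1‖, sq_nonneg ‖p.2‖]

theorem complexScale_mem_euclBall {ρ : ℝ} {a : ℂ} (ha : ‖a‖ ≤ 1) {p : E × E}
    (hp : p ∈ euclBall E ρ) : complexScale a p ∈ euclBall E ρ := by
  have h : ‖a.re • p.1 - a.im • p.2‖ ^ 2 + ‖a.im • p.1 + a.re • p.2‖ ^ 2
      = ‖a‖ ^ 2 * (‖p.1‖ ^ 2 + ‖p.2‖ ^ 2) := by
    rw [norm_sub_sq_real, norm_add_sq_real, ← Complex.normSq_eq_norm_sq, Complex.normSq_apply]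
    simp only [norm_smul, inner_smul_left, inner_smul_right, mul_pow, Real.norm_eq_abs, sq_abs]
    simp
    ring
  have hp' : ‖p.1‖ ^ 2 + ‖p.2‖ ^ 2 < ρ ^ 2 := hp
  change ‖a.re • p.1 - a.im • p.2‖ ^ 2 + ‖a.im • p.1 + a.re • p.2‖ ^ 2 < ρ ^ 2
  rw [h]
  have : ‖a‖ ^ 2 ≤ 1 := pow_le_one₀ (norm_nonneg a) ha
  nlinarith [sq_nonneg ‖p.1‖, sq_nonneg ‖p.2‖]

theorem volume_euclBall_pos {ρ : ℝ} (hρ : 0 < ρ) :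
    (volume.prod volume : Measure (E × E)) (euclBall E ρ) ≠ 0 :=
  ((isOpen_euclBall ρ).measure_pos _ ⟨0, zero_mem_euclBall hρ⟩).ne'

theorem volume_euclBall_lt_top {ρ : ℝ} (hρ : 0 < ρ) :
    (volume.prod volume : Measure (E × E)) (euclBall E ρ) ≠ ⊤ := by
  refine ne_top_of_le_ne_top (Metric.isBounded_ball (x := (0 : E × E)) (r := ρ)).measure_lt_top.ne
    (measure_mono fun p hp => ?_)
  have := norm_lt_of_mem_euclBall hρ hp
  rw [mem_ball_zero_iff, Prod.norm_def]
  exact max_lt this.1 this.2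

theorem complexScale_mul (a b : ℂ) (p : E × E) :
    complexScale (a * b) p = complexScale a (complexScale b p) := by
  simp only [complexScale_apply, Complex.mul_re, Complex.mul_im]
  ext <;> dsimp only <;> module

/-- A linear bijection scales Lebesgue measure by a constant; the constant is 1 because the
Euclidean ball is preserved and has finite positive volume. -/
theorem measurePreserving_complexScale {a : ℂ} (ha : ‖a‖ = 1) :
    MeasurePreserving (complexScale (E := E) a) (volume.prod volume) (volume.prod volume) := by
  have hc : Continuous (complexScale (E := E) a) :=
    LinearMap.continuous_of_finiteDimensional _
  have ha0 : a ≠ 0 := by rintro rfl; simp at ha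
  have hinv : complexScale (E := E) a ∘ₗ complexScale a⁻¹ = LinearMap.id := by
    ext1 <;> ext1 p <;> simp [← complexScale_mul, ha0] <;> simp [complexScale_apply]
  have hinv' : complexScale (E := E) a⁻¹ ∘ₗ complexScale a = LinearMap.id := by
    ext1 <;> ext1 p <;> simp [← complexScale_mul, ha0] <;> simp [complexScale_apply]
  have hdet : LinearMap.det (complexScale (E := E) a) ≠ 0 := by
    intro h0
    have := congrArg LinearMap.det hinv
    rw [LinearMap.det_comp, h0, zero_mul, LinearMap.det_id] at this
    exact zero_ne_one this
  have hmap := Measure.map_linearMap_addHaar_eq_smul_addHaar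
    (volume.prod volume : Measure (E × E)) hdet
  have hpre : complexScale (E := E) a ⁻¹' euclBall E 1 = euclBall E 1 := by
    ext p
    refine ⟨fun hp => ?_, fun hp => complexScale_mem_euclBall ha.le hp⟩
    have := complexScale_mem_euclBall (a := a⁻¹) (by rw [norm_inv, ha, inv_one]) hp
    rwa [← LinearMap.comp_apply, hinv', LinearMap.id_apply] at this
  have h1 := congrArg (fun m : Measure (E × E) => m (euclBall E 1)) hmap
  simp only [Measure.smul_apply, smul_eq_mul] at h1
  rw [Measure.map_apply hc.measurable (isOpen_euclBall 1).measurableSet, hpre] at h1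
  refine ⟨hc.measurable, ?_⟩
  rw [hmap, (ENNReal.mul_eq_right (volume_euclBall_pos one_pos)
    (volume_euclBall_lt_top one_pos)).1 h1.symm, one_smul]

/-- The mean value inequality for the square of a function that is holomorphic on the complex
lines through the centre of a ball. -/
theorem enorm_sq_mul_volume_le {ρ : ℝ} {G : E × E → ℂ}
    (hG : ContinuousOn G (euclBall E ρ))
    (hline : ∀ w ∈ euclBall E ρ,
      DiffContOnCl ℂ (fun a : ℂ => G (complexScale a w)) (Metric.ball 0 1)) :
    ‖G 0‖ₑ ^ 2 * (volume.prod volume : Measure (E × E)) (euclBall E ρ)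
      ≤ ∫⁻ w in euclBall E ρ, ‖G w‖ₑ ^ 2 ∂(volume.prod volume) := by
  classical
  set B := euclBall E ρ
  have hB : MeasurableSet B := (isOpen_euclBall ρ).measurableSet
  let f : E × E → ENNReal := fun w => ‖B.piecewise G 0 w‖ₑ ^ 2
  have hf : Measurable f :=
    (ContinuousOn.measurable_piecewise hG continuousOn_const hB).enorm.pow_const 2
  have hfB : ∀ w ∈ B, f w = ‖G w‖ₑ ^ 2 := fun w hw => by
    simp only [f, Set.piecewise_eq_of_mem _ _ _ hw]
  have hcirc : ∀ θ : ℝ, ‖circleMap 0 1 θ‖ = 1 := fun θ => by simp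
  have hrot : ∀ θ : ℝ, ∀ w ∈ B, complexScale (circleMap 0 1 θ) w ∈ B := fun θ w hw =>
    complexScale_mem_euclBall (hcirc θ).le hw
  have hcont : Continuous fun p : (E × E) × ℝ => complexScale (circleMap 0 1 p.2) p.1 := by
    simp only [complexScale_apply]
    have h1 : Continuous fun p : (E × E) × ℝ => circleMap 0 1 p.2 :=
      (continuous_circleMap 0 1).comp continuous_snd
    have h2 := Complex.continuous_re.comp h1
    have h3 := Complex.continuous_im.comp h1
    simp only [Function.comp_def] at h2 h3
    fun_prop
  -- The circle average of G² on the complex line through w is G(0)². Integrating over w and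
  -- exchanging integrals leaves rotations of the ball, which preserve volume.
  have hpt : ∀ w ∈ B, ‖G 0‖ₑ ^ 2 ≤ ENNReal.ofReal (2 * Real.pi)⁻¹ *
      ∫⁻ θ in Set.Ioc 0 (2 * Real.pi), f (complexScale (circleMap 0 1 θ) w) := by
    intro w hw
    have h1 : DiffContOnCl ℂ (fun a : ℂ => G (complexScale a w) ^ 2) (Metric.ball 0 |1|) := by
      simp only [pow_two, abs_one]
      exact (hline w hw).smul (hline w hw)
    have h2 := h1.circleAverage
    have h3 : complexScale (0 : ℂ) w = 0 := by simp [complexScale_apply]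
    rw [Real.circleAverage, h3, intervalIntegral.integral_of_le (by positivity)] at h2
    rw [← enorm_pow, ← h2, enorm_smul, Real.enorm_eq_ofReal (by positivity)]
    gcongr
    refine (enorm_integral_le_lintegral_enorm _).trans (le_of_eq ?_)
    refine lintegral_congr fun θ => ?_
    rw [enorm_pow, hfB _ (hrot θ w hw)]
  calc ‖G 0‖ₑ ^ 2 * (volume.prod volume : Measure (E × E)) B
      = ∫⁻ w in B, ‖G 0‖ₑ ^ 2 ∂(volume.prod volume) := by rw [setLIntegral_const]
    _ ≤ ∫⁻ w in B, ENNReal.ofReal (2 * Real.pi)⁻¹ *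
          (∫⁻ θ in Set.Ioc 0 (2 * Real.pi), f (complexScale (circleMap 0 1 θ) w))
          ∂(volume.prod volume) := setLIntegral_mono' hB hpt
    _ = ENNReal.ofReal (2 * Real.pi)⁻¹ * ∫⁻ θ in Set.Ioc 0 (2 * Real.pi),
          (∫⁻ w in B, f (complexScale (circleMap 0 1 θ) w) ∂(volume.prod volume)) := by
        rw [lintegral_const_mul' _ _ ENNReal.ofReal_ne_top, lintegral_lintegral_swap]
        exact (hf.comp hcont.measurable).aemeasurable
    _ ≤ ENNReal.ofReal (2 * Real.pi)⁻¹ * ∫⁻ θ in Set.Ioc 0 (2 * Real.pi),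
          (∫⁻ w, f w ∂(volume.prod volume)) := by
        refine mul_le_mul_right (lintegral_mono fun θ => ?_) _
        refine (setLIntegral_le_lintegral _ _).trans (le_of_eq ?_)
        exact (measurePreserving_complexScale (hcirc θ)).lintegral_comp hf
    _ = ∫⁻ w, f w ∂(volume.prod volume) := by
        rw [setLIntegral_const, Real.volume_Ioc, sub_zero, mul_comm (∫⁻ w, f w ∂_), ← mul_assoc,
          ← ENNReal.ofReal_mul (by positivity), inv_mul_cancel₀ (by positivity), ENNReal.ofReal_one,
          one_mul]
    _ = ∫⁻ w in B, ‖G w‖ₑ ^ 2 ∂(volume.prod volume) := by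
        rw [← lintegral_indicator hB]
        refine lintegral_congr fun w => ?_
        by_cases hw : w ∈ B
        · rw [Set.indicator_of_mem hw, hfB w hw]
        · simp [f, hw]

/-- Change of variables under an affine map acting on both components. -/
theorem setLIntegral_comp_affine (g : E →ₗ[ℝ] E) (hg : LinearMap.det g ≠ 0) (x y : E)
    {B : Set (E × E)} (hB : MeasurableSet B) (f : E × E → ENNReal) :
    ∫⁻ p in (fun w : E × E => (x + g w.1, y + g w.2)) '' B, f p ∂(volume.prod volume)
      = ENNReal.ofReal (LinearMap.det g ^ 2) *
        ∫⁻ w in B, f (x + g w.1, y + g w.2) ∂(volume.prod volume) := by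
  let g' : E × E →L[ℝ] E × E := LinearMap.toContinuousLinearMap (g.prodMap g)
  have hg' : ∀ w, (x + g w.1, y + g w.2) = (x, y) + g' w := fun w => rfl
  have hker : Function.Injective g := by
    rw [← LinearMap.ker_eq_bot]
    by_contra h
    exact hg (LinearMap.det_eq_zero_iff_ker_ne_bot.2 h)
  have hd : g'.det = LinearMap.det g ^ 2 := by
    rw [pow_two, ← LinearMap.det_prodMap]; rfl
  have := lintegral_image_eq_lintegral_abs_det_fderiv_mul
    (volume.prod volume : Measure (E × E)) hB
    (f := fun w : E × E => (x + g w.1, y + g w.2)) (f' := fun _ => g')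
    (fun w _ => (g'.hasFDerivAt.const_add (x, y)).hasFDerivWithinAt)
    (fun w _ w' _ h => by
      simp only [Prod.mk.injEq, add_right_inj] at h
      exact Prod.ext (hker h.1) (hker h.2)) f
  rw [this, lintegral_const_mul' _ _ ENNReal.ofReal_ne_top, hd, abs_of_nonneg (sq_nonneg _)]

end MeanValue

/-! ### Pointwise bounds in Bergman spaces -/

theorem jdet_pos [IsSimpleRing V] {y : V} (hy : y ∈ cone V) : 0 < jdet y := by
  rw [jdet_eq hy]
  exact Real.rpow_pos_of_pos (quadDet_pos hy) _

theorem jdet_unit [IsSimpleRing V] : jdet (unit V) = 1 := by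
  rw [jdet_eq unit_mem_cone, quadDet_unit, Real.one_rpow]

theorem jdet_flow [IsSimpleRing V] (h : V) {w : V} (hw : w ∈ cone V) :
    jdet (flow h w) = jdet (flow h (unit V)) * jdet w := by
  rw [jdet_eq (flow_mem_cone h hw), jdet_eq (flow_mem_cone h unit_mem_cone), jdet_eq hw,
    quadDet_flow_unit, quadDet_flow, Real.mul_rpow (sq_nonneg _) (quadDet_pos hw).le]

/-- The square is the Jacobian of the flow acting on real and imaginary parts together; with
`jdet_flow` it makes Δ(y)^(-2n/r) dx dy invariant. -/
theorem det_flow_sq_eq [IsSimpleRing V] (h : V) : (flow h).det ^ 2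
    = jdet (flow h (unit V)) ^ (2 * (Module.finrank ℝ V : ℝ) / (rank V : ℝ)) := by
  have := nontrivial_of_isSimpleRing (V := V)
  have hr : (rank V : ℝ) ≠ 0 := Nat.cast_ne_zero.2 rank_pos.ne'
  have hn : (Module.finrank ℝ V : ℝ) ≠ 0 := Nat.cast_ne_zero.2 Module.finrank_pos.ne'
  rw [jdet_eq (flow_mem_cone h unit_mem_cone), quadDet_flow_unit, ← Real.rpow_mul (sq_nonneg _)]
  conv_lhs => rw [← Real.rpow_one ((flow h).det ^ 2)]
  congr 1
  field_simp

theorem continuousOn_jdet [IsSimpleRing V] : ContinuousOn (jdet : V → ℝ) (cone V) := by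
  refine ContinuousOn.congr (f := fun y : V =>
    quadDet y ^ ((rank V : ℝ) / (2 * (Module.finrank ℝ V : ℝ)))) ?_ fun y hy => jdet_eq hy
  exact continuous_quadDet.continuousOn.rpow_const fun y hy => Or.inl (quadDet_pos hy).ne'

open Filter Topology in
theorem exists_radius [IsSimpleRing V] (s : ℝ) : ∃ ρ > 0, ∀ v : V, ‖v‖ < ρ →
    unit V + v ∈ cone V ∧ 1 / 2 ≤ jdet (unit V + v) ^ s := by
  have h1 : ∀ᶠ y in 𝓝 (unit V), y ∈ cone V := isOpen_cone.mem_nhds unit_mem_cone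
  have h2 : Tendsto (fun y : V => jdet y ^ s) (𝓝 (unit V)) (𝓝 (jdet (unit V) ^ s)) :=
    (continuousOn_jdet.continuousAt (isOpen_cone.mem_nhds unit_mem_cone)).tendsto.rpow_const
      (Or.inl (by rw [jdet_unit]; exact one_ne_zero))
  rw [jdet_unit, Real.one_rpow] at h2
  have h3 := h1.and (h2.eventually (lt_mem_nhds (show (1 / 2 : ℝ) < 1 by norm_num)))
  obtain ⟨ρ, hρ, hball⟩ := Metric.eventually_nhds_iff.1 h3
  refine ⟨ρ, hρ, fun v hv => ?_⟩
  have := hball (y := unit V + v) (by simpa [dist_eq_norm] using hv)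
  exact ⟨this.1, this.2.le⟩

theorem toComplexification_mem_tube {p : V × V} (hp : p.2 ∈ cone V) :
    toComplexification (E := V) p ∈ tube V := ⟨p.1, p.2, hp, rfl⟩

/-- Every function in a weighted Bergman space satisfies `|F(x + iy)|² ≤ K Δ(y) ^ (-ν)`. -/
theorem MemBergman.exists_bound [IsSimpleRing V] [MeasurableSpace V] [BorelSpace V] {ν : ℝ}
    {F : ℂ ⊗[ℝ] V → ℂ} (hF : MemBergman ν F) : ∃ K : ENNReal, K ≠ ⊤ ∧
      ∀ x : V, ∀ y ∈ cone V, ‖F (1 ⊗ₜ[ℝ] x + Complex.I ⊗ₜ[ℝ] y)‖ₑ ^ 2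
        ≤ K * ENNReal.ofReal (jdet y ^ (-ν)) := by
  obtain ⟨hdiff, hfin⟩ := hF
  set s : ℝ := ν - 2 * (Module.finrank ℝ V : ℝ) / (rank V : ℝ)
  obtain ⟨ρ, hρ, hball⟩ := exists_radius (V := V) s
  set m := (volume.prod volume : Measure (V × V)) (euclBall V ρ)
  have hm0 : m ≠ 0 := volume_euclBall_pos hρ
  have hmt : m ≠ ⊤ := volume_euclBall_lt_top hρ
  refine ⟨m⁻¹ * (ENNReal.ofReal 2 * bergmanNormSq ν F), ENNReal.mul_ne_top
    (ENNReal.inv_ne_top.2 hm0) (ENNReal.mul_ne_top ENNReal.ofReal_ne_top hfin.ne), ?_⟩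
  intro x y hy
  obtain ⟨h, rfl⟩ := exists_flow_unit_eq hy
  set y := flow h (unit V) with hydef
  have hjy := jdet_pos hy
  -- Since y = exp L(h) e, the imaginary part of T(w) is exp L(h)(e + w₂), which lies in the cone
  -- for w in the ball.
  let T : V × V → V × V := fun w => (x + flow h w.1, y + flow h w.2)
  have hT2 : ∀ w : V × V, (T w).2 = flow h (unit V + w.2) := fun w => by
    simp only [T, map_add, hydef]
  have hcone : ∀ w ∈ euclBall V ρ, (T w).2 ∈ cone V := fun w hw => by
    rw [hT2]
    exact flow_mem_cone h (hball _ (norm_lt_of_mem_euclBall hρ hw).2).1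
  have hTcont : Continuous T := by
    have hf : Continuous (flow h) := LinearMap.continuous_of_finiteDimensional (E := V) (flow h)
    exact (continuous_const.add (hf.comp continuous_fst)).prodMk
      (continuous_const.add (hf.comp continuous_snd))
  let G : V × V → ℂ := fun w => F (toComplexification (E := V) (T w))
  have hG : ContinuousOn G (euclBall V ρ) :=
    (continuousOn_of_differentiableOn_complexification (E := V) hdiff).comp
      ((continuous_toComplexification (E := V)).comp hTcont).continuousOn
      fun w hw => toComplexification_mem_tube (hcone w hw)
  have hscale : ∀ (a : ℂ) (w : V × V), toComplexification (E := V) (T (complexScale (E := V) a w))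
      = toComplexification (E := V) (x, y)
        + a • toComplexification (E := V) (flow h w.1, flow h w.2) := by
    intro a w
    rw [← toComplexification_complexScale (E := V), ← toComplexification_add (E := V)]
    congr 1
    simp [T, complexScale_apply]
  have hline : ∀ w ∈ euclBall V ρ,
      DiffContOnCl ℂ (fun a : ℂ => G (complexScale (E := V) a w)) (Metric.ball 0 1) := by
    intro w hw
    have := diffContOnCl_line (E := V) (F := F) (S := tube V) hdiff
      (z := toComplexification (E := V) (x, y))
      (w := toComplexification (E := V) (flow h w.1, flow h w.2)) (fun a ha => by
        rw [← hscale]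
        exact toComplexification_mem_tube (hcone _ (complexScale_mem_euclBall (E := V)
          (by simpa using ha) hw)))
    simp only [G, hscale]
    exact this
  have hmean := enorm_sq_mul_volume_le (E := V) hG hline
  have hG0 : G 0 = F (1 ⊗ₜ[ℝ] x + Complex.I ⊗ₜ[ℝ] y) := by
    simp [G, T, toComplexification]
  let f : V × V → ENNReal := fun p => ENNReal.ofReal
    (‖F (1 ⊗ₜ[ℝ] p.1 + Complex.I ⊗ₜ[ℝ] p.2)‖ ^ 2 * jdet p.2 ^ s)
  -- By the choice of ρ, the weight at T(w) is Δ(y)^s Δ(e + w₂)^s ≥ Δ(y)^s / 2.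
  have hpt : ∀ w ∈ euclBall V ρ, ‖G w‖ₑ ^ 2 ≤ ENNReal.ofReal (2 * jdet y ^ (-s)) * f (T w) := by
    intro w hw
    have hb := hball _ (norm_lt_of_mem_euclBall hρ hw).2
    have hj : jdet (T w).2 ^ s = jdet y ^ s * jdet (unit V + w.2) ^ s := by
      rw [hT2, jdet_flow h hb.1, Real.mul_rpow hjy.le (jdet_pos hb.1).le]
    have hys : jdet y ^ (-s) * jdet y ^ s = 1 := by
      rw [← Real.rpow_add hjy, neg_add_cancel, Real.rpow_zero]
    rw [← ofReal_norm, ← ENNReal.ofReal_pow (norm_nonneg _),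
      ← ENNReal.ofReal_mul (by positivity)]
    apply ENNReal.ofReal_le_ofReal
    change ‖G w‖ ^ 2 ≤ 2 * jdet y ^ (-s) * (‖G w‖ ^ 2 * jdet (T w).2 ^ s)
    rw [hj]
    have : 2 * jdet y ^ (-s) * (‖G w‖ ^ 2 * (jdet y ^ s * jdet (unit V + w.2) ^ s))
        = ‖G w‖ ^ 2 * (2 * jdet (unit V + w.2) ^ s) * (jdet y ^ (-s) * jdet y ^ s) := by ring
    rw [this, hys, mul_one]
    exact le_mul_of_one_le_right (sq_nonneg _) (by linarith [hb.2])
  have hmeas : MeasurableSet (euclBall V ρ) := (isOpen_euclBall ρ).measurableSet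
  have hchange := setLIntegral_comp_affine (E := V) (flow h) (det_flow_pos h).ne' x y hmeas f
  have himage : ∫⁻ p in T '' euclBall V ρ, f p ∂(volume.prod volume) ≤ bergmanNormSq ν F := by
    refine lintegral_mono_set ?_
    rintro _ ⟨w, hw, rfl⟩
    exact ⟨trivial, hcone w hw⟩
  have hd2 : 0 < (flow h).det ^ 2 := pow_pos (det_flow_pos h) 2
  have hint : ∫⁻ w in euclBall V ρ, f (T w) ∂(volume.prod volume)
      ≤ ENNReal.ofReal (((flow h).det ^ 2)⁻¹) * bergmanNormSq ν F := by
    refine le_trans (le_of_eq ?_) (mul_le_mul_right himage _)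
    rw [hchange, ← mul_assoc, ← ENNReal.ofReal_mul (by positivity), inv_mul_cancel₀ hd2.ne',
      ENNReal.ofReal_one, one_mul]
  -- The weight contributes the exponent -s and the Jacobian -2n/r; their sum is -ν.
  have hexp : 2 * jdet y ^ (-s) * ((flow h).det ^ 2)⁻¹ = 2 * jdet y ^ (-ν) := by
    rw [det_flow_sq_eq, ← hydef, ← Real.rpow_neg hjy.le, mul_assoc, ← Real.rpow_add hjy]
    congr 2
    simp only [s]
    ring
  have hfinal : ‖G 0‖ₑ ^ 2 * m ≤ ENNReal.ofReal (2 * jdet y ^ (-ν)) * bergmanNormSq ν F := by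
    refine hmean.trans ((setLIntegral_mono' hmeas hpt).trans ?_)
    rw [lintegral_const_mul' _ _ ENNReal.ofReal_ne_top]
    refine (mul_le_mul_right hint _).trans (le_of_eq ?_)
    rw [← mul_assoc, ← ENNReal.ofReal_mul (by positivity), hexp]
  rw [← hG0]
  calc ‖G 0‖ₑ ^ 2 = m⁻¹ * (‖G 0‖ₑ ^ 2 * m) := by
        rw [mul_comm (‖G 0‖ₑ ^ 2), ← mul_assoc, ENNReal.inv_mul_cancel hm0 hmt, one_mul]
    _ ≤ m⁻¹ * (ENNReal.ofReal (2 * jdet y ^ (-ν)) * bergmanNormSq ν F) := mul_le_mul_right hfinal _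
    _ = m⁻¹ * (ENNReal.ofReal 2 * bergmanNormSq ν F) * ENNReal.ofReal (jdet y ^ (-ν)) := by
        rw [ENNReal.ofReal_mul (by norm_num)]
        ring

end EJA

end

/-! ### Products of Bergman functions -/

theorem mainTheorem1 {V : Type*} [NonUnitalNonAssocCommRing V] [Module ℝ V]
    [IsScalarTower ℝ V V] [SMulCommClass ℝ V V] [EJA.EuclideanJordanAlgebra V]
    [IsSimpleRing V] [MeasurableSpace V] [BorelSpace V] (ν₁ ν₂ : ℝ)
    (hν₁ : 2 * (Module.finrank ℝ V : ℝ) / (EJA.rank V : ℝ) - 1 < ν₁)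
    (hν₂ : 2 * (Module.finrank ℝ V : ℝ) / (EJA.rank V : ℝ) - 1 < ν₂)
    (F₁ F₂ : ℂ ⊗[ℝ] V → ℂ) (hF₁ : EJA.MemBergman ν₁ F₁) (hF₂ : EJA.MemBergman ν₂ F₂) :
    EJA.MemBergman (ν₁ + ν₂) (fun z => F₁ z * F₂ z) := by
  refine ⟨EJA.differentiableOn_mul_complexification (E := V) hF₁.1 hF₂.1, ?_⟩
  -- Only F₂ is bounded pointwise; its factor Δ(y)^(-ν₂) lowers the weight of the product to that of
  -- F₁.
  obtain ⟨K, hK, hbound⟩ := hF₂.exists_bound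
  refine lt_of_le_of_lt ?_ (ENNReal.mul_lt_top hK.lt_top hF₁.2)
  rw [EJA.bergmanNormSq, EJA.bergmanNormSq, ← lintegral_const_mul' _ _ hK]
  refine setLIntegral_mono' (MeasurableSet.univ.prod EJA.isOpen_cone.measurableSet) ?_
  rintro ⟨x, y⟩ ⟨-, hy⟩
  have hjy := EJA.jdet_pos hy
  set s : ℝ := 2 * (Module.finrank ℝ V : ℝ) / (EJA.rank V : ℝ)
  set z : ℂ ⊗[ℝ] V := 1 ⊗ₜ[ℝ] x + Complex.I ⊗ₜ[ℝ] y
  have h1 : EJA.jdet y ^ (-ν₂) * EJA.jdet y ^ (ν₁ + ν₂ - s) = EJA.jdet y ^ (ν₁ - s) := by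
    rw [← Real.rpow_add hjy]
    congr 1
    ring
  calc ENNReal.ofReal (‖F₁ z * F₂ z‖ ^ 2 * EJA.jdet y ^ (ν₁ + ν₂ - s))
      = ‖F₂ z‖ₑ ^ 2 * ENNReal.ofReal (‖F₁ z‖ ^ 2 * EJA.jdet y ^ (ν₁ + ν₂ - s)) := by
        rw [← ofReal_norm, ← ENNReal.ofReal_pow (norm_nonneg _),
          ← ENNReal.ofReal_mul (by positivity), norm_mul]
        congr 1
        ring
    _ ≤ K * ENNReal.ofReal (EJA.jdet y ^ (-ν₂))
          * ENNReal.ofReal (‖F₁ z‖ ^ 2 * EJA.jdet y ^ (ν₁ + ν₂ - s)) :=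
        mul_le_mul_left (hbound x y hy) _
    _ = K * ENNReal.ofReal (‖F₁ z‖ ^ 2 * EJA.jdet y ^ (ν₁ - s)) := by
        rw [mul_assoc, ← ENNReal.ofReal_mul (by positivity), ← h1]
        congr 2
        ring
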